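/- **Notation.** Let $q(x,y)=-x_1y_1-x_2y_2+x_3y_3+x_4y_4$ on $\mathbb R^4$, $q(x)=q(x,x)$, and $\mathrm{AdS}_3=\{x\in\mathbb R^4 : q(x)=-1\}$. The boundary $\partial\mathrm{AdS}_3$ is the set of rays $[\nu]=\mathbb R_{>0}\,\nu$ with $\nu\ne0$, $q(\nu)=0$; every such ray has a unique representative $(w,z)\in\mathbb S^1\times\mathbb S^1\subset\mathbb C\times\mathbb C=\mathbb R^4$. $\mathrm{Isom}(\mathrm{AdS}_3)_\circ$ denotes the identity component of the group $\mathrm O(2,2)$ of linear automorphisms of $\mathbb R^4$ preserving $q$. For $U\subset \mathrm{AdS}_3$ put $T^1U=\{(x,v)\in\mathbb R^4\times\mathbb R^4 : x\in U,\ q(x,v)=0,\ q(v)=1\}$. On $T^1\mathrm{AdS}_3$ the spacelike geodesic flow is $\varphi_t(x,v)=(x\cosh t+v\sinh t,\ x\sinh t+v\cosh t)$, and $\gamma\in\mathrm O(2,2)$ acts by $\gamma(x,v)=(\gamma x,\gamma v)$. Write $\pi(x,v)=x$. An *acausal circle* is a set $\Lambda=\{[(F(z),z)] : z\in\mathbb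 S^1\}\subset\partial\mathrm{AdS}_3$ with $F:\mathbb S^1\to\mathbb S^1$ satisfying $|F(z)-F(z')|<|z-z'|$ for all $z\neq z'$. Its convex hull is $C(\Lambda)=\{x/\sqrt{|q(x)|} : x\in\mathrm{Conv}(\widetilde\Lambda),\ q(x)<0\}$, where $\widetilde\Lambda=\{(F(z),z): z\in\mathbb S^1\}\subset\mathbb R^4$, and its invisible domain is $\mathcal O_+(\Lambda)=\{x\in\mathrm{AdS}_3 : q(x,\nu)<0 \text{ for all } [\nu]\in\Lambda\}$. A subgroup $\Gamma\subset\mathrm{Isom}(\mathrm{AdS}_3)_\circ$ is *quasi-Fuchsian* with limit set $\Lambda_\Gamma$ if it preserves the acausal circle $\Lambda_\Gamma$ and acts freely, properly discontinuously and cocompactly on $C(\Lambda_\Gamma)$. (An action on $S$ is properly discontinuous if for all compact $K,L\subset S$ only finitely many $\gamma$ satisfy $\gamma K\cap L\ne\emptyset$.) **Proposition.** Let $\Gamma$ be a quasi-Fuchsian group with limit set $\Lambda_\Gamma$, and let $$\widetilde{\mathcal M}=\bigcup_{t\in\mathbb R}\varphi_t\bigl(T^1\mathcal O_+(\Lambda_\Gamma)\bigr).$$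 1. $\widetilde{\mathcal M}=\{(x,v)\in T^1\mathrm{AdS}_3 : \exists\,t\in\mathbb R,\ \pi(\varphi_t(x,v))\in\mathcal O_+(\Lambda_\Gamma)\}$; this is an open subset of $T^1\mathrm{AdS}_3$, invariant under every $\varphi_t$ and under $\Gamma$. 2. The action of $\Gamma$ on $\widetilde{\mathcal M}$ is free and properly discontinuous. 3. The quotient $\mathcal M=\Gamma\backslash\widetilde{\mathcal M}$ is Hausdorff and second countable. The quotients $\mathcal M$ and $T^1M:=\Gamma\backslash T^1\mathcal O_+(\Lambda_\Gamma)$, where $M=\Gamma\backslash\mathcal O_+(\Lambda_\Gamma)$, carry smooth structures of dimension $5$ for which the projections $\widetilde{\mathcal M}\to\mathcal M$ and $T^1\mathcal O_+(\Lambda_\Gamma)\to T^1M$ are local diffeomorphisms ($\widetilde{\mathcal M}$ and $T^1\mathcal O_+(\Lambda_\Gamma)$ being smooth embedded submanifolds of $\mathbb R^4\times\mathbb R^4$). The map $T^1M\to\mathcal M$ induced by the inclusion $T^1\mathcal O_+(\Lambda_\Gamma)\subset\widetilde{\mathcal M}$ is an open topological embedding and a local diffeomorphism, so $T^1M$ is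 an open submanifold of $\mathcal M$. 4. The flow $\varphi_t$ descends to a complete smooth flow on $\mathcal M$: there is a flow $\Psi_t$, $t\in\mathbb R$, smooth as a map $\mathbb R\times\mathcal M\to\mathcal M$, with $\Psi_t([p])=[\varphi_t(p)]$ for all $p\in\widetilde{\mathcal M}$ and $t\in\mathbb R$. -/

import Mathlib

open scoped Manifold ContDiff

noncomputable section

namespace AdS

/-- The ambient space `ℝ⁴`; the coordinates `x₁, …, x₄` are `x 0, …, x 3`. -/
abbrev V : Type := Fin 4 → ℝ

/-- The bilinear form `q(x, y) = -x₁y₁ - x₂y₂ + x₃y₃ + x₄y₄`. -/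
def q (x y : V) : ℝ := -(x 0 * y 0) - x 1 * y 1 + x 2 * y 2 + x 3 * y 3

/-- Three-dimensional anti-de Sitter space, the quadric `q(x, x) = -1`. -/
def AdS3 : Set V := {x | q x x = -1}

/-- The unit spacelike tangent bundle of a subset `U` of anti-de Sitter space: the pairs `(x, v)`
with `x ∈ U`, `v ∈ T_x AdS₃`, i.e. `q(x, v) = 0`, and `q(v, v) = 1`. -/
def T1 (U : Set V) : Set (V × V) := {p | p.1 ∈ U ∧ q p.1 p.2 = 0 ∧ q p.2 p.2 = 1}

/-- The group of invertible linear maps of `ℝ⁴`, with its usual topology. -/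
abbrev GLV : Type := (V →L[ℝ] V)ˣ

/-- The orthogonal group `O(2,2)` of `q`, which is the isometry group of `AdS₃`. -/
def O22 : Subgroup GLV where
  carrier := {h | ∀ x y, q (h • x) (h • y) = q x y}
  mul_mem' := by
    intro a b ha hb x y
    rw [mul_smul, mul_smul, ha, hb]
  one_mem' := by
    intro x y
    simp
  inv_mem' := by
    intro a ha x y
    rw [← ha, smul_inv_smul, smul_inv_smul]

/-- The identity component `SO(2,2)_∘` of `O(2,2)`, which is `Isom(AdS₃)_∘`. -/
def IsomConn : Subgroup GLV :=
  (Subgroup.connectedComponentOfOne O22).map O22.subtype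

/-- The conformal boundary `∂AdS₃`: the rays `[ν]` (nonzero vectors up to positive scaling)
with `q(ν, ν) = 0`. -/
def Boundary : Set (Module.Ray ℝ V) :=
  {r | ∃ (ν : V) (hν : ν ≠ 0), q ν ν = 0 ∧ r = rayOfNeZero ℝ ν hν}

/-- The point `(w, z)` of the torus `𝕊¹ × 𝕊¹ ⊆ ℂ × ℂ = ℝ⁴`. -/
def torusPoint (w z : Circle) : V :=
  ![(w : ℂ).re, (w : ℂ).im, (z : ℂ).re, (z : ℂ).im]

theorem torusPoint_ne_zero (w z : Circle) : torusPoint w z ≠ 0 := by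
  intro h
  have h0 : (w : ℂ).re = 0 := congrFun h 0
  have h1 : (w : ℂ).im = 0 := congrFun h 1
  exact w.coe_ne_zero (Complex.ext h0 h1)

/-- The point of `∂AdS₃` with torus coordinates `(w, z)`. -/
def boundaryPoint (w z : Circle) : Module.Ray ℝ V :=
  rayOfNeZero ℝ (torusPoint w z) (torusPoint_ne_zero w z)

theorem boundaryPoint_mem (w z : Circle) : boundaryPoint w z ∈ Boundary := by
  refine ⟨_, torusPoint_ne_zero w z, ?_, rfl⟩
  have hw : (w : ℂ).re * (w : ℂ).re + (w : ℂ).im * (w : ℂ).im = 1 := by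
    rw [← Complex.normSq_apply]; exact Circle.normSq_coe w
  have hz : (z : ℂ).re * (z : ℂ).re + (z : ℂ).im * (z : ℂ).im = 1 := by
    rw [← Complex.normSq_apply]; exact Circle.normSq_coe z
  simp only [q, torusPoint, Matrix.cons_val]
  linarith

/-- Acausal circles in `∂AdS₃`: the graphs, in torus coordinates, of the strictly
distance-decreasing maps of the circle. -/
def IsAcausalCircle (Λ : Set (Module.Ray ℝ V)) : Prop :=
  ∃ F : Circle → Circle,
    (∀ z z' : Circle, z ≠ z' → ‖(F z : ℂ) - (F z' : ℂ)‖ < ‖(z : ℂ) - (z' : ℂ)‖) ∧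
    Λ = {r | ∃ z : Circle, r = boundaryPoint (F z) z}

/-- The lift to the torus `𝕊¹ × 𝕊¹ ⊆ ℝ⁴` of a subset of the boundary. -/
def torusLift (Λ : Set (Module.Ray ℝ V)) : Set V :=
  {ν | ∃ w z : Circle, ν = torusPoint w z ∧ boundaryPoint w z ∈ Λ}

/-- The convex hull `C(Λ) ⊆ AdS₃`: the radial projection to `AdS₃` of the part `q < 0` of the
convex hull in `ℝ⁴` of the torus lift of `Λ`. -/
def convexCore (Λ : Set (Module.Ray ℝ V)) : Set V :=
  {y | ∃ x ∈ convexHull ℝ (torusLift Λ), q x x < 0 ∧ y = (Real.sqrt |q x x|)⁻¹ • x}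

/-- The invisible domain `𝒪₊(Λ) = {x ∈ AdS₃ | q(x, ν) < 0 for all [ν] ∈ Λ}`. -/
def invisibleDomain (Λ : Set (Module.Ray ℝ V)) : Set V :=
  {x | x ∈ AdS3 ∧ ∀ (ν : V) (hν : ν ≠ 0), rayOfNeZero ℝ ν hν ∈ Λ → q x ν < 0}

section Actions

variable {G X : Type*} [Group G] [MulAction G X]

/-- The subgroup `Γ` acts freely on the invariant subset `S`. -/
def ActsFreelyOn (Γ : Subgroup G) (S : Set X) : Prop :=
  ∀ γ ∈ Γ, ∀ x ∈ S, γ • x = x → γ = 1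

/-- The subgroup `Γ` acts properly discontinuously on the invariant subset `S`: for any two compact
subsets `K`, `L` of `S`, only finitely many `γ ∈ Γ` satisfy `γK ∩ L ≠ ∅`. -/
def ActsProperlyDiscontinuouslyOn [TopologicalSpace X] (Γ : Subgroup G) (S : Set X) : Prop :=
  ∀ K L : Set X, K ⊆ S → L ⊆ S → IsCompact K → IsCompact L →
    {γ : G | γ ∈ Γ ∧ (((fun x => γ • x) '' K) ∩ L).Nonempty}.Finite

/-- The subgroup `Γ` acts cocompactly on the invariant subset `S`. -/
def ActsCocompactlyOn [TopologicalSpace X] (Γ : Subgroup G) (S : Set X) : Prop :=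
  ∃ K : Set X, K ⊆ S ∧ IsCompact K ∧ ∀ x ∈ S, ∃ γ ∈ Γ, γ • x ∈ K

end Actions

/-- `Γ` is a quasi-Fuchsian group with limit set `Λ`: a subgroup of `Isom(AdS₃)_∘` that preserves
the acausal circle `Λ` and acts freely, properly discontinuously and cocompactly on `C(Λ)`. -/
structure IsQuasiFuchsian (Γ : Subgroup GLV) (Λ : Set (Module.Ray ℝ V)) : Prop where
  le_isom : Γ ≤ IsomConn
  acausal : IsAcausalCircle Λ
  preserves : ∀ γ ∈ Γ, (fun r => γ • r) '' Λ = Λ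
  free : ActsFreelyOn Γ (convexCore Λ)
  properlyDiscontinuous : ActsProperlyDiscontinuouslyOn Γ (convexCore Λ)
  cocompact : ActsCocompactlyOn Γ (convexCore Λ)

/-- The spacelike geodesic flow,
`φ_t(x, v) = (x cosh t + v sinh t, x sinh t + v cosh t)`. -/
def φ (t : ℝ) (p : V × V) : V × V :=
  (Real.cosh t • p.1 + Real.sinh t • p.2, Real.sinh t • p.1 + Real.cosh t • p.2)

/-- The flowout `ℳ̃ = ⋃ₜ φ_t(T¹𝒪₊(Λ))`. -/
def flowout (Λ : Set (Module.Ray ℝ V)) : Set (V × V) :=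
  ⋃ t : ℝ, φ t '' T1 (invisibleDomain Λ)

theorem φ_add (s t : ℝ) (p : V × V) : φ (s + t) p = φ s (φ t p) := by
  ext i <;> simp [φ, Real.cosh_add, Real.sinh_add] <;> ring

theorem φ_smul (t : ℝ) (γ : GLV) (p : V × V) : φ t (γ • p) = γ • φ t p := by
  ext i <;> simp [φ, smul_add, smul_comm γ]

theorem q_smul {Γ : Subgroup GLV} {Λ : Set (Module.Ray ℝ V)} (h : IsQuasiFuchsian Γ Λ)
    {γ : GLV} (hγ : γ ∈ Γ) (x y : V) : q (γ • x) (γ • y) = q x y := by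
  obtain ⟨g, -, rfl⟩ := h.le_isom hγ
  exact g.2 x y

theorem smul_mem_T1 {Γ : Subgroup GLV} {Λ : Set (Module.Ray ℝ V)} (h : IsQuasiFuchsian Γ Λ)
    {γ : GLV} (hγ : γ ∈ Γ) {p : V × V} (hp : p ∈ T1 (invisibleDomain Λ)) :
    γ • p ∈ T1 (invisibleDomain Λ) := by
  obtain ⟨⟨h1, h2⟩, h3, h4⟩ := hp
  refine ⟨⟨(q_smul h hγ _ _).trans h1, fun ν hν hΛ => ?_⟩,
    (q_smul h hγ _ _).trans h3, (q_smul h hγ _ _).trans h4⟩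
  have hν' : γ⁻¹ • ν ≠ 0 := (smul_ne_zero_iff_ne _).2 hν
  have key : rayOfNeZero ℝ (γ⁻¹ • ν) hν' ∈ Λ := by
    rw [← smul_rayOfNeZero γ⁻¹ ν hν, ← h.preserves γ⁻¹ (Γ.inv_mem hγ)]
    exact ⟨_, hΛ, rfl⟩
  have := h2 _ hν' key
  rwa [← q_smul h hγ, smul_inv_smul] at this

/-- `T¹𝒪₊(Λ)` with its action of `Γ`. -/
def tangentSub {Γ : Subgroup GLV} {Λ : Set (Module.Ray ℝ V)} (h : IsQuasiFuchsian Γ Λ) :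
    SubMulAction Γ (V × V) where
  carrier := T1 (invisibleDomain Λ)
  smul_mem' := fun γ _ hp => smul_mem_T1 h γ.2 hp

/-- The flowout `ℳ̃` with its action of `Γ`. -/
def flowoutSub {Γ : Subgroup GLV} {Λ : Set (Module.Ray ℝ V)} (h : IsQuasiFuchsian Γ Λ) :
    SubMulAction Γ (V × V) where
  carrier := flowout Λ
  smul_mem' := by
    intro γ p hp
    obtain ⟨t, y, hy, rfl⟩ := Set.mem_iUnion.1 hp
    exact Set.mem_iUnion.2 ⟨t, (γ : GLV) • y, smul_mem_T1 h γ.2 hy, φ_smul t γ y⟩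

/-- The restriction of the geodesic flow to the flowout `ℳ̃`. -/
def flowoutFlow {Γ : Subgroup GLV} {Λ : Set (Module.Ray ℝ V)} (h : IsQuasiFuchsian Γ Λ)
    (t : ℝ) (p : flowoutSub h) : flowoutSub h :=
  ⟨φ t p.1, by
    obtain ⟨s, y, hy, hp⟩ := Set.mem_iUnion.1 p.2
    exact Set.mem_iUnion.2 ⟨t + s, y, hy, by rw [φ_add, hp]⟩⟩

/-- The quotient `Γ \ S` of an invariant subset of `ℝ⁴ × ℝ⁴`, with the quotient topology. -/
abbrev Quo {Γ : Subgroup GLV} (S : SubMulAction Γ (V × V)) : Type :=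
  MulAction.orbitRel.Quotient Γ S

/-- The projection `S → Γ \ S`. -/
def proj {Γ : Subgroup GLV} (S : SubMulAction Γ (V × V)) (p : S) : Quo S :=
  Quotient.mk _ p

/-- The map `T¹M = Γ \ T¹𝒪₊(Λ) → ℳ = Γ \ ℳ̃` induced by the inclusion `T¹𝒪₊(Λ) ⊆ ℳ̃`. -/
def inclQuo {Γ : Subgroup GLV} {Λ : Set (Module.Ray ℝ V)} (h : IsQuasiFuchsian Γ Λ) :
    Quo (tangentSub h) → Quo (flowoutSub h) :=
  Quotient.map
    (fun p => ⟨p.1, Set.mem_iUnion.2 ⟨0, p.1, p.2, by ext i <;> simp [φ]⟩⟩)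
    (by
      rintro a b ⟨γ, hγ⟩
      exact ⟨γ, Subtype.ext (congrArg (fun x : tangentSub h => x.1) hγ)⟩)

/-- The model space of five-dimensional manifolds. -/
abbrev E5 : Type := EuclideanSpace ℝ (Fin 5)

/-- The atlas `c` on `Γ \ S` is a smooth five-dimensional manifold structure induced from `S`, in
the sense that `S` is a smooth embedded five-dimensional submanifold of `ℝ⁴ × ℝ⁴` and the projection
`S → Γ \ S` is a local diffeomorphism. -/
def IsQuotientStructure {Γ : Subgroup GLV} (S : SubMulAction Γ (V × V))
    (c : ChartedSpace E5 (Quo S)) : Prop :=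
  IsManifold 𝓘(ℝ, E5) ∞ (Quo S) ∧
  ∃ _cS : ChartedSpace E5 S,
    IsManifold 𝓘(ℝ, E5) ∞ S ∧
    Manifold.IsSmoothEmbedding 𝓘(ℝ, E5) 𝓘(ℝ, V × V) ∞ (Subtype.val : S → V × V) ∧
    IsLocalDiffeomorph 𝓘(ℝ, E5) 𝓘(ℝ, E5) ∞ (proj S)

end AdS

end

section

open Set Filter Topology

namespace AdS

/-! The hypotheses control `Γ` only on the convex core, so the point is to transfer proper
discontinuity and freeness from there to the flowout.

Fix `c = ν₁ + ν₂` with `ν₁ ≠ ν₂` in the torus lift; acausality gives `q c c < 0`. Let `x` lie in the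
invisible domain. Since the lift is compact, `q y ν ≤ -ε` for all `y` near `x` and all `ν` in the
lift. An element `γ⁻¹` sends a lift point `ν` to `r • μ` with `r > 0` and `μ` in the lift, and `r *
q y μ = q (γ • y) ν`. So a bound `R` on `‖γ • y‖` bounds `r` by `4 * R / ε`. Then `γ⁻¹ • c` is a
bounded combination of two lift points with prescribed negative norm; such vectors normalise to a
compact part of the convex core, and only finitely many `γ` are possible (`exists_nhds_finite`).

The base point of `φ t p` is linear in `p` and `φ` commutes with `Γ`, so the same finiteness holds
near every point of the flowout, which gives proper discontinuity. It also makes any element fixing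
a point of finite order. Such an element fixes the sum of the finite orbit of `c`, hence a point of
the core, so it is trivial (`eq_one_of_isOfFinOrder`).

The rest is differential topology. `T1 AdS3` is a regular level set, so its relatively open subsets
are five-dimensional submanifolds. The quotients by `Γ` are bases of coverings with smooth deck
transformations. Smoothness of the induced inclusion and flow is checked upstairs, where the maps
are restrictions of smooth maps of the ambient space. -/

theorem q_comm (x y : V) : q x y = q y x := by simp only [q]; ring

theorem q_add_left (x y z : V) : q (x + y) z = q x z + q y z := by
  simp only [q, Pi.add_apply]; ring

theorem q_add_right (x y z : V) : q x (y + z) = q x y + q x z := by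
  simp only [q, Pi.add_apply]; ring

theorem q_smul_left (r : ℝ) (x y : V) : q (r • x) y = r * q x y := by
  simp only [q, Pi.smul_apply, smul_eq_mul]; ring

theorem q_smul_right (r : ℝ) (x y : V) : q x (r • y) = r * q x y := by
  simp only [q, Pi.smul_apply, smul_eq_mul]; ring

theorem q_sub_left (x y z : V) : q (x - y) z = q x z - q y z := by
  simp only [q, Pi.sub_apply]; ring

theorem q_zero_left (x : V) : q 0 x = 0 := by simp [q]

theorem abs_q_le (x y : V) : |q x y| ≤ 4 * (‖x‖ * ‖y‖) := by
  have h : ∀ i, |x i * y i| ≤ ‖x‖ * ‖y‖ := fun i => by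
    rw [abs_mul]
    exact mul_le_mul (norm_le_pi_norm x i) (norm_le_pi_norm y i) (abs_nonneg _) (norm_nonneg _)
  have h0 := abs_le.1 (h 0)
  have h1 := abs_le.1 (h 1)
  have h2 := abs_le.1 (h 2)
  have h3 := abs_le.1 (h 3)
  rw [abs_le, q]
  constructor <;> linarith

theorem continuous_q : Continuous fun p : V × V => q p.1 p.2 := by
  unfold q; fun_prop

theorem convex_q_le (x : V) : Convex ℝ {y | q x y ≤ 0} := by
  intro y hy z hz a b ha hb hab
  simp only [mem_ofPred_eq] at *
  rw [q_add_right, q_smul_right, q_smul_right]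
  nlinarith

/-! ### Torus coordinates on the boundary -/

section Torus

/-- For unit complex numbers the real inner product is `1 - ‖w - w'‖ ^ 2 / 2`, and the two constants
cancel in `q`. This turns the contraction property of an acausal circle into a sign of `q`. -/
theorem q_torusPoint (w z w' z' : Circle) :
    q (torusPoint w z) (torusPoint w' z') =
      (‖(w : ℂ) - w'‖ ^ 2 - ‖(z : ℂ) - z'‖ ^ 2) / 2 := by
  have h (u : Circle) : (u : ℂ).re * (u : ℂ).re + (u : ℂ).im * (u : ℂ).im = 1 := by
    rw [← Complex.normSq_apply]; exact Circle.normSq_coe u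
  rw [← Complex.normSq_eq_norm_sq, ← Complex.normSq_eq_norm_sq, Complex.normSq_apply,
    Complex.normSq_apply]
  simp only [q, torusPoint, Matrix.cons_val, Complex.sub_re, Complex.sub_im]
  linarith [h w, h w', h z, h z']

theorem norm_torusPoint_le (w z : Circle) : ‖torusPoint w z‖ ≤ 1 := by
  have h1 := Circle.norm_coe w
  have h2 := Circle.norm_coe z
  rw [pi_norm_le_iff_of_nonneg zero_le_one]
  intro i
  fin_cases i
  · exact (Complex.abs_re_le_norm _).trans h1.le
  · exact (Complex.abs_im_le_norm _).trans h1.le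
  · exact (Complex.abs_re_le_norm _).trans h2.le
  · exact (Complex.abs_im_le_norm _).trans h2.le

theorem torusPoint_of_smul_eq {w z w' z' : Circle} {r : ℝ} (hr : 0 < r)
    (h : torusPoint w z = r • torusPoint w' z') : w = w' ∧ z = z' := by
  have e0 : (w : ℂ).re = r * (w' : ℂ).re := congrFun h 0
  have e1 : (w : ℂ).im = r * (w' : ℂ).im := congrFun h 1
  have e2 : (z : ℂ).re = r * (z' : ℂ).re := congrFun h 2
  have e3 : (z : ℂ).im = r * (z' : ℂ).im := congrFun h 3
  have h (u : Circle) : (u : ℂ).re * (u : ℂ).re + (u : ℂ).im * (u : ℂ).im = 1 := by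
    rw [← Complex.normSq_apply]; exact Circle.normSq_coe u
  have h1 := h w
  rw [e0, e1] at h1
  have hr1 : r * r = 1 := by linear_combination h1 - r * r * h w'
  replace hr1 : r = 1 := by nlinarith
  subst hr1
  exact ⟨Circle.ext (Complex.ext (by linarith) (by linarith)),
    Circle.ext (Complex.ext (by linarith) (by linarith))⟩

theorem boundaryPoint_inj {w z w' z' : Circle} (h : boundaryPoint w z = boundaryPoint w' z') :
    w = w' ∧ z = z' := by
  obtain ⟨r, s, hr, hs, hrs⟩ := ((ray_eq_iff (torusPoint_ne_zero w z)
    (torusPoint_ne_zero w' z')).1 h).exists_pos (torusPoint_ne_zero w z) (torusPoint_ne_zero w' z')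
  refine torusPoint_of_smul_eq (r := r⁻¹ * s) (by positivity) ?_
  rw [mul_smul, ← hrs, inv_smul_smul₀ hr.ne']

end Torus

/-! ### Acausal circles, the invisible domain and the cone over the hull -/

section AcausalCircle

variable {Λ : Set (Module.Ray ℝ V)}

theorem torusLift_graph {F : Circle → Circle} :
    torusLift {r | ∃ z : Circle, r = boundaryPoint (F z) z} =
      range fun z => torusPoint (F z) z := by
  ext ν
  constructor
  · rintro ⟨w, z, rfl, z', h⟩
    obtain ⟨rfl, rfl⟩ := boundaryPoint_inj h
    exact ⟨z, rfl⟩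
  · rintro ⟨z, rfl⟩
    exact ⟨F z, z, rfl, z, rfl⟩

theorem norm_le_of_mem_torusLift {ν : V} (hν : ν ∈ torusLift Λ) : ‖ν‖ ≤ 1 := by
  obtain ⟨w, z, rfl, -⟩ := hν
  exact norm_torusPoint_le w z

/-- A distance-decreasing `F` is 1-Lipschitz, hence continuous, so its graph is a continuous image
of the circle. -/
theorem IsAcausalCircle.isCompact_torusLift (h : IsAcausalCircle Λ) :
    IsCompact (torusLift Λ) := by
  obtain ⟨F, hF, rfl⟩ := h
  rw [torusLift_graph]
  have hlip : LipschitzWith 1 F := LipschitzWith.of_dist_le_mul fun z z' => by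
    rcases eq_or_ne z z' with rfl | hz
    · simp
    · rw [NNReal.coe_one, one_mul]
      change dist (F z : ℂ) (F z') ≤ dist (z : ℂ) z'
      rw [dist_eq_norm, dist_eq_norm]
      exact (hF z z' hz).le
  have hc : Continuous F := hlip.continuous
  refine isCompact_range (continuous_pi fun i => ?_)
  have h1 : Continuous fun z : Circle => ((F z : ℂ)) := continuous_subtype_val.comp hc
  have h2 : Continuous fun z : Circle => (z : ℂ) := continuous_subtype_val
  fin_cases i
  · exact Complex.continuous_re.comp h1
  · exact Complex.continuous_im.comp h1
  · exact Complex.continuous_re.comp h2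
  · exact Complex.continuous_im.comp h2

theorem IsAcausalCircle.q_neg (h : IsAcausalCircle Λ) {ν ν' : V} (hν : ν ∈ torusLift Λ)
    (hν' : ν' ∈ torusLift Λ) (hne : ν ≠ ν') : q ν ν' < 0 := by
  obtain ⟨F, hF, rfl⟩ := h
  rw [torusLift_graph] at hν hν'
  obtain ⟨z, rfl⟩ := hν
  obtain ⟨z', rfl⟩ := hν'
  have hz : z ≠ z' := by rintro rfl; exact hne rfl
  have := hF z z' hz
  rw [q_torusPoint]
  have := pow_lt_pow_left₀ this (norm_nonneg _) two_ne_zero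
  linarith

theorem q_self_of_mem_torusLift {ν : V} (hν : ν ∈ torusLift Λ) : q ν ν = 0 := by
  obtain ⟨w, z, rfl, -⟩ := hν
  simp [q_torusPoint]

theorem IsAcausalCircle.q_nonpos (h : IsAcausalCircle Λ) {ν ν' : V} (hν : ν ∈ torusLift Λ)
    (hν' : ν' ∈ torusLift Λ) : q ν ν' ≤ 0 := by
  rcases eq_or_ne ν ν' with rfl | hne
  · exact (q_self_of_mem_torusLift hν).le
  · exact (h.q_neg hν hν' hne).le

theorem IsAcausalCircle.q_nonpos_convexHull (h : IsAcausalCircle Λ) {x y : V}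
    (hx : x ∈ convexHull ℝ (torusLift Λ)) (hy : y ∈ convexHull ℝ (torusLift Λ)) : q x y ≤ 0 := by
  have h1 : ∀ ν ∈ torusLift Λ, q ν y ≤ 0 := fun ν hν =>
    convexHull_min (fun ν' hν' => h.q_nonpos hν hν') (convex_q_le ν) hy
  rw [q_comm]
  exact convexHull_min (fun ν hν => (q_comm y ν).trans_le (h1 ν hν)) (convex_q_le y) hx

theorem IsAcausalCircle.exists_ne_mem_torusLift (h : IsAcausalCircle Λ) :
    ∃ ν₁ ∈ torusLift Λ, ∃ ν₂ ∈ torusLift Λ, ν₁ ≠ ν₂ := by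
  obtain ⟨F, hF, rfl⟩ := h
  rw [torusLift_graph]
  refine ⟨_, ⟨1, rfl⟩, _, ⟨-1, rfl⟩, fun h => ?_⟩
  have := congrFun h 2
  simp [torusPoint] at this
  norm_num at this

/-- The sum of two distinct points of the lift is a timelike vector that pairs negatively with the
whole lift. -/
theorem IsAcausalCircle.q_add_neg (h : IsAcausalCircle Λ) {ν₁ ν₂ : V} (h₁ : ν₁ ∈ torusLift Λ)
    (h₂ : ν₂ ∈ torusLift Λ) (hne : ν₁ ≠ ν₂) {ν : V} (hν : ν ∈ torusLift Λ) :
    q (ν₁ + ν₂) ν < 0 := by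
  rw [q_add_left]
  rcases eq_or_ne ν₁ ν with rfl | hν₁
  · linarith [h.q_nonpos h₁ hν, h.q_neg h₂ hν hne.symm]
  · linarith [h.q_nonpos h₂ hν, h.q_neg h₁ hν hν₁]

/-- The sign of `q x ν` does not change under positive scaling of `ν`, so it can be tested on the
compact lift, where uniform bounds are available. -/
theorem IsAcausalCircle.mem_invisibleDomain (h : IsAcausalCircle Λ) {x : V} :
    x ∈ invisibleDomain Λ ↔ x ∈ AdS3 ∧ ∀ ν ∈ torusLift Λ, q x ν < 0 := by
  refine and_congr_right fun _ => ⟨fun H ν hν => ?_, fun H ν hν hΛ => ?_⟩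
  · obtain ⟨w, z, rfl, hwz⟩ := hν
    exact H _ (torusPoint_ne_zero w z) hwz
  · obtain ⟨F, -, rfl⟩ := h
    obtain ⟨z, hz⟩ := hΛ
    obtain ⟨r, s, hr, hs, hrs⟩ := ((ray_eq_iff hν (torusPoint_ne_zero _ _)).1 hz).exists_pos
      hν (torusPoint_ne_zero _ _)
    have h1 := H (torusPoint (F z) z) ⟨F z, z, rfl, z, rfl⟩
    have h2 : r * q x ν = s * q x (torusPoint (F z) z) := by
      rw [← q_smul_right, hrs, q_smul_right]
    by_contra! hc
    have := mul_nonneg hr.le hc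
    nlinarith [mul_neg_of_pos_of_neg hs h1]

/-- Pairing negatively with the lift of an acausal circle is a uniform and open condition. -/
theorem IsAcausalCircle.exists_nhds_q_le (h : IsAcausalCircle Λ) {x : V}
    (hx : ∀ ν ∈ torusLift Λ, q x ν < 0) :
    ∃ ε > 0, ∃ U ∈ 𝓝 x, ∀ y ∈ U, ∀ ν ∈ torusLift Λ, q y ν ≤ -ε := by
  obtain ⟨ν₁, hν₁, -⟩ := h.exists_ne_mem_torusLift
  obtain ⟨ν₀, hν₀, hmax⟩ := h.isCompact_torusLift.exists_isMaxOn ⟨ν₁, hν₁⟩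
    (f := fun ν => q x ν) (continuous_q.comp (Continuous.prodMk_right x)).continuousOn
  have hε : 0 < -q x ν₀ := neg_pos.2 (hx ν₀ hν₀)
  -- By `abs_q_le`, moving `x` by less than `-q x ν₀ / 8` changes its pairing with lift points, of
  -- norm at most 1, by at most half of `-q x ν₀`.
  refine ⟨-q x ν₀ / 2, by linarith, Metric.ball x (-q x ν₀ / 8),
    Metric.ball_mem_nhds _ (by linarith), fun y hy ν hν => ?_⟩
  have h1 : q x ν ≤ q x ν₀ := hmax hν
  have h2 := (abs_le.1 (abs_q_le (y - x) ν)).2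
  rw [q_sub_left] at h2
  rw [mem_ball_iff_norm] at hy
  have h3 : ‖y - x‖ * ‖ν‖ ≤ -q x ν₀ / 8 * 1 :=
    mul_le_mul hy.le (norm_le_of_mem_torusLift hν) (norm_nonneg _) (by linarith)
  linarith

theorem IsAcausalCircle.invisibleDomain_eq (h : IsAcausalCircle Λ) :
    ∃ W : Set V, IsOpen W ∧ invisibleDomain Λ = W ∩ AdS3 := by
  refine ⟨{x | ∀ ν ∈ torusLift Λ, q x ν < 0}, ?_, ?_⟩
  · refine isOpen_iff_mem_nhds.2 fun x hx => ?_
    obtain ⟨ε, hε, U, hU, H⟩ := h.exists_nhds_q_le hx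
    exact mem_of_superset hU fun y hy ν hν => (H y hy ν hν).trans_lt (by linarith)
  · ext x
    rw [h.mem_invisibleDomain, inter_comm]
    rfl

/-- The open cone over the convex hull of the lift of `Λ`. -/
noncomputable def hullCone (Λ : Set (Module.Ray ℝ V)) : ConvexCone ℝ V :=
  ConvexCone.hull ℝ (convexHull ℝ (torusLift Λ))

theorem mem_hullCone {x : V} :
    x ∈ hullCone Λ ↔ ∃ t : ℝ, 0 < t ∧ ∃ y ∈ convexHull ℝ (torusLift Λ), t • y = x :=
  ConvexCone.mem_hull_of_convex (convex_convexHull ℝ _)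

theorem torusLift_subset_hullCone : torusLift Λ ⊆ hullCone Λ := fun ν hν =>
  mem_hullCone.2 ⟨1, one_pos, ν, subset_convexHull ℝ _ hν, one_smul _ _⟩

/-- Describes the core through the cone instead of the hull: `Γ` preserves the rays of `Λ` but not
their representatives in the lift, so only the cone is `Γ`-invariant. -/
theorem mem_convexCore {x : V} : x ∈ convexCore Λ ↔ x ∈ hullCone Λ ∧ q x x = -1 := by
  constructor
  · rintro ⟨y, hy, hq, rfl⟩
    have hs : 0 < Real.sqrt |q y y| := Real.sqrt_pos.2 (abs_pos.2 hq.ne)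
    refine ⟨mem_hullCone.2 ⟨_, inv_pos.2 hs, y, hy, rfl⟩, ?_⟩
    rw [q_smul_left, q_smul_right, ← mul_assoc, ← mul_inv, Real.mul_self_sqrt (abs_nonneg _),
      abs_of_neg hq, ← neg_inv, neg_mul, inv_mul_cancel₀ hq.ne]
  · rintro ⟨hx, hq⟩
    obtain ⟨t, ht, y, hy, rfl⟩ := mem_hullCone.1 hx
    rw [q_smul_left, q_smul_right, ← mul_assoc] at hq
    have hq' : q y y = -(t * t)⁻¹ := by
      field_simp; linarith
    refine ⟨y, hy, by rw [hq']; simp [ht.ne'], ?_⟩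
    rw [hq', abs_neg, abs_of_pos (by positivity), Real.sqrt_inv, Real.sqrt_mul_self ht.le,
      inv_inv]

theorem normalize_mem_convexCore {x : V} (hx : x ∈ hullCone Λ) (hq : q x x < 0) :
    (Real.sqrt |q x x|)⁻¹ • x ∈ convexCore Λ := by
  have hs : 0 < Real.sqrt |q x x| := Real.sqrt_pos.2 (abs_pos.2 hq.ne)
  refine mem_convexCore.2 ⟨(hullCone Λ).smul_mem (inv_pos.2 hs) hx, ?_⟩
  rw [q_smul_left, q_smul_right, ← mul_assoc, ← mul_inv, Real.mul_self_sqrt (abs_nonneg _),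
    abs_of_neg hq, ← neg_inv, neg_mul, inv_mul_cancel₀ hq.ne]

theorem IsAcausalCircle.q_nonpos_hullCone (h : IsAcausalCircle Λ) {x y : V}
    (hx : x ∈ hullCone Λ) (hy : y ∈ hullCone Λ) : q x y ≤ 0 := by
  obtain ⟨s, hs, x, hx', rfl⟩ := mem_hullCone.1 hx
  obtain ⟨t, ht, y, hy', rfl⟩ := mem_hullCone.1 hy
  rw [q_smul_left, q_smul_right]
  exact mul_nonpos_of_nonneg_of_nonpos hs.le
    (mul_nonpos_of_nonneg_of_nonpos ht.le (h.q_nonpos_convexHull hx' hy'))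

/-- The timelike vectors of given length that are combinations with bounded coefficients of two
points of the lift form a compact subset of the open cone over its convex hull. -/
theorem IsAcausalCircle.exists_isCompact_subset_hullCone (h : IsAcausalCircle Λ) (M : ℝ) {a : ℝ}
    (ha : a < 0) :
    ∃ D : Set V, IsCompact D ∧ D ⊆ hullCone Λ ∧
      ∀ s ∈ Icc 0 M, ∀ t ∈ Icc 0 M, ∀ μ ∈ torusLift Λ, ∀ ν ∈ torusLift Λ,
        q (s • μ + t • ν) (s • μ + t • ν) = a → s • μ + t • ν ∈ D := by
  have hK := h.isCompact_torusLift
  refine ⟨((fun p : (ℝ × V) × (ℝ × V) => p.1.1 • p.1.2 + p.2.1 • p.2.2) ''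
    ((Icc 0 M ×ˢ torusLift Λ) ×ˢ (Icc 0 M ×ˢ torusLift Λ))) ∩ {x | q x x = a}, ?_, ?_, ?_⟩
  · refine (((isCompact_Icc.prod hK).prod (isCompact_Icc.prod hK)).image (by fun_prop)).inter_right
      (isClosed_eq (continuous_q.comp (continuous_id.prodMk continuous_id)) continuous_const)
  · rintro _ ⟨⟨⟨⟨s, μ⟩, t, ν⟩, ⟨⟨hs, hμ⟩, ht, hν⟩, rfl⟩, hq⟩
    simp only [mem_ofPred_eq] at hs hμ ht hν hq ⊢
    have hμ' := torusLift_subset_hullCone hμ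
    have hν' := torusLift_subset_hullCone hν
    -- Compactness needs the coefficient 0 to be allowed, while the cone needs positive ones. Both
    -- cannot vanish, because `a < 0`.
    rcases hs.1.eq_or_lt with rfl | hs
    · rw [zero_smul, zero_add] at hq ⊢
      refine (hullCone Λ).smul_mem (lt_of_le_of_ne ht.1 ?_) hν'
      rintro rfl
      rw [zero_smul, q_zero_left] at hq
      exact ha.ne' hq
    · rcases ht.1.eq_or_lt with rfl | ht
      · rw [zero_smul, add_zero]
        exact (hullCone Λ).smul_mem hs hμ'
      · exact (hullCone Λ).add_mem ((hullCone Λ).smul_mem hs hμ') ((hullCone Λ).smul_mem ht hν')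
  · intro s hs t ht μ hμ ν hν hq
    exact ⟨⟨((s, μ), t, ν), ⟨⟨hs, hμ⟩, ht, hν⟩, rfl⟩, hq⟩

end AcausalCircle

/-! ### Finiteness of returns near the invisible domain -/

variable {Γ : Subgroup GLV} {Λ : Set (Module.Ray ℝ V)}

theorem IsQuasiFuchsian.exists_smul_torusLift (h : IsQuasiFuchsian Γ Λ) {γ : GLV} (hγ : γ ∈ Γ)
    {ν : V} (hν : ν ∈ torusLift Λ) : ∃ r : ℝ, 0 < r ∧ ∃ μ ∈ torusLift Λ, γ • ν = r • μ := by
  obtain ⟨w, z, rfl, hwz⟩ := hν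
  have hne : γ • torusPoint w z ≠ 0 := (smul_ne_zero_iff_ne _).2 (torusPoint_ne_zero w z)
  have key : rayOfNeZero ℝ (γ • torusPoint w z) hne ∈ Λ := by
    rw [← smul_rayOfNeZero γ _ (torusPoint_ne_zero w z), ← h.preserves γ hγ]
    exact ⟨_, hwz, rfl⟩
  obtain ⟨F, -, rfl⟩ := h.acausal
  obtain ⟨z', hz'⟩ := key
  obtain ⟨r, s, hr, hs, hrs⟩ := ((ray_eq_iff hne (torusPoint_ne_zero _ _)).1 hz').exists_pos
    hne (torusPoint_ne_zero _ _)
  refine ⟨r⁻¹ * s, by positivity, _, ⟨F z', z', rfl, z', rfl⟩, ?_⟩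
  rw [mul_smul, ← hrs, inv_smul_smul₀ hr.ne']

theorem glv_smul_smul (γ : GLV) (r : ℝ) (x : V) : γ • r • x = r • γ • x := smul_comm γ r x

theorem IsQuasiFuchsian.smul_mem_hullCone (h : IsQuasiFuchsian Γ Λ) {γ : GLV} (hγ : γ ∈ Γ)
    {x : V} (hx : x ∈ hullCone Λ) : γ • x ∈ hullCone Λ := by
  obtain ⟨t, ht, y, hy, rfl⟩ := mem_hullCone.1 hx
  rw [glv_smul_smul]
  refine (hullCone Λ).smul_mem ht ?_
  have hc : Convex ℝ {y : V | γ • y ∈ hullCone Λ} := by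
    intro y hy z hz a b ha hb hab
    simp only [mem_ofPred_eq] at *
    rw [smul_add, glv_smul_smul, glv_smul_smul]
    exact (hullCone Λ).convex hy hz ha hb hab
  refine convexHull_min (fun ν hν => ?_) hc hy
  obtain ⟨r, hr, μ, hμ, e⟩ := h.exists_smul_torusLift hγ hν
  simp only [mem_ofPred_eq, e]
  exact (hullCone Λ).smul_mem hr (torusLift_subset_hullCone hμ)

/-- Orbits of points near a point of the invisible domain leave every bounded set of `ℝ⁴`. -/
theorem IsQuasiFuchsian.exists_nhds_finite (h : IsQuasiFuchsian Γ Λ) {x : V}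
    (hx : x ∈ invisibleDomain Λ) (R : ℝ) :
    ∃ U ∈ 𝓝 x, {γ : GLV | γ ∈ Γ ∧ ∃ y ∈ U, ‖γ • y‖ ≤ R}.Finite := by
  have hA := h.acausal
  obtain ⟨ε, hε, U, hU, hUε⟩ := hA.exists_nhds_q_le (hA.mem_invisibleDomain.1 hx).2
  obtain ⟨ν₁, h₁, ν₂, h₂, hne⟩ := hA.exists_ne_mem_torusLift
  have hcc : q (ν₁ + ν₂) (ν₁ + ν₂) < 0 := by
    rw [q_add_right]
    linarith [hA.q_add_neg h₁ h₂ hne h₁, hA.q_add_neg h₁ h₂ hne h₂]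
  obtain ⟨D, hD, hDC, hmem⟩ := hA.exists_isCompact_subset_hullCone (4 * R / ε) hcc
  set c := ν₁ + ν₂ with hc
  set s := (Real.sqrt |q c c|)⁻¹ with hs
  -- The compact sets are the normalised point `c` and the normalised vectors of `D` of norm `q c
  -- c`; as `q` is preserved, one factor `s` normalises `c` and all its translates.
  have hfin := h.properlyDiscontinuous {s • c} ((fun x => s • x) '' (D ∩ {x | q x x = q c c}))
    (singleton_subset_iff.2 (normalize_mem_convexCore ((hullCone Λ).add_mem
      (torusLift_subset_hullCone h₁) (torusLift_subset_hullCone h₂)) hcc)) ?_ isCompact_singleton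
    ((hD.inter_right (isClosed_eq (continuous_q.comp (continuous_id.prodMk continuous_id))
      continuous_const)).image (continuous_const_smul s))
  · refine ⟨U, hU, (hfin.preimage (f := fun γ => γ⁻¹) inv_injective.injOn).subset ?_⟩
    rintro γ ⟨hγ, y, hy, hR⟩
    -- In `q (γ • y) ν = r * q y μ` the left side is at least `-4 * R` and the right side at most
    -- `-ε * r`.
    have key : ∀ ν ∈ torusLift Λ, ∃ r ∈ Icc 0 (4 * R / ε), ∃ μ ∈ torusLift Λ, γ⁻¹ • ν = r • μ := by
      intro ν hν
      obtain ⟨r, hr, μ, hμ, e⟩ := h.exists_smul_torusLift (Γ.inv_mem hγ) hν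
      refine ⟨r, ⟨hr.le, ?_⟩, μ, hμ, e⟩
      have e1 : q (γ • y) ν = r * q y μ := by
        rw [← q_smul_right, ← e, ← q_smul h (Γ.inv_mem hγ), inv_smul_smul]
      have e2 := (abs_le.1 (abs_q_le (γ • y) ν)).1
      have e3 : ‖γ • y‖ * ‖ν‖ ≤ R * 1 := mul_le_mul hR (norm_le_of_mem_torusLift hν)
        (norm_nonneg _) ((norm_nonneg _).trans hR)
      have e4 := mul_le_mul_of_nonneg_left (hUε y hy μ hμ) hr.le
      rw [le_div_iff₀ hε]
      linarith
    obtain ⟨r₁, hr₁, μ₁, hμ₁, e₁⟩ := key ν₁ h₁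
    obtain ⟨r₂, hr₂, μ₂, hμ₂, e₂⟩ := key ν₂ h₂
    have e : γ⁻¹ • c = r₁ • μ₁ + r₂ • μ₂ := by rw [hc, smul_add, e₁, e₂]
    have hq : q (γ⁻¹ • c) (γ⁻¹ • c) = q c c := q_smul h (Γ.inv_mem hγ) _ _
    refine ⟨Γ.inv_mem hγ, s • γ⁻¹ • c, ⟨s • c, rfl, smul_comm _ _ _⟩, γ⁻¹ • c, ⟨?_, hq⟩, rfl⟩
    rw [e] at hq ⊢
    exact hmem r₁ hr₁ r₂ hr₂ μ₁ hμ₁ μ₂ hμ₂ hq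
  · rintro _ ⟨x, ⟨hx, hq⟩, rfl⟩
    simp only [mem_ofPred_eq] at hq
    have := normalize_mem_convexCore (hDC hx) (by rw [hq]; exact hcc)
    rwa [hq] at this

/-! ### The geodesic flow and the action on the flowout -/

theorem φ_zero (p : V × V) : φ 0 p = p := by ext i <;> simp [φ]

theorem φ_neg_φ (t : ℝ) (p : V × V) : φ (-t) (φ t p) = p := by
  rw [← φ_add, neg_add_cancel, φ_zero]

theorem φ_φ_neg (t : ℝ) (p : V × V) : φ t (φ (-t) p) = p := by
  rw [← φ_add, add_neg_cancel, φ_zero]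

theorem contDiff_φ {n : ℕ∞ω} : ContDiff ℝ n fun a : ℝ × (V × V) => φ a.1 a.2 := by
  unfold φ
  have h1 : ContDiff ℝ n fun a : ℝ × (V × V) => Real.cosh a.1 :=
    Real.contDiff_cosh.comp contDiff_fst
  have h2 : ContDiff ℝ n fun a : ℝ × (V × V) => Real.sinh a.1 :=
    Real.contDiff_sinh.comp contDiff_fst
  fun_prop

theorem continuous_φ (t : ℝ) : Continuous (φ t) :=
  (contDiff_φ (n := 0)).continuous.comp (Continuous.prodMk_right t)

theorem φ_mem_T1 (t : ℝ) {p : V × V} (hp : p ∈ T1 AdS3) : φ t p ∈ T1 AdS3 := by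
  obtain ⟨h1, h2, h3⟩ := hp
  have h1 : q p.1 p.1 = -1 := h1
  have h4 : q p.2 p.1 = 0 := (q_comm _ _).trans h2
  have h5 := Real.cosh_sq t
  refine ⟨?_, ?_, ?_⟩ <;>
  simp only [φ, AdS3, mem_ofPred_eq, q_add_left, q_add_right, q_smul_left, q_smul_right, h1, h2, h3,
    h4] <;> linarith

theorem T1_invisibleDomain : T1 (invisibleDomain Λ) ⊆ T1 AdS3 := fun _ hp => ⟨hp.1.1, hp.2⟩

theorem mem_flowout {p : V × V} :
    p ∈ flowout Λ ↔ p ∈ T1 AdS3 ∧ ∃ t : ℝ, (φ t p).1 ∈ invisibleDomain Λ := by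
  constructor
  · intro hp
    obtain ⟨t, y, hy, rfl⟩ := mem_iUnion.1 hp
    exact ⟨φ_mem_T1 t (T1_invisibleDomain hy), -t, by rw [φ_neg_φ]; exact hy.1⟩
  · rintro ⟨hp, t, ht⟩
    exact mem_iUnion.2 ⟨-t, φ t p, ⟨ht, (φ_mem_T1 t hp).2⟩, φ_neg_φ t p⟩

theorem IsAcausalCircle.flowout_eq (h : IsAcausalCircle Λ) :
    ∃ W : Set (V × V), IsOpen W ∧ flowout Λ = W ∩ T1 AdS3 := by
  obtain ⟨W, hW, e⟩ := h.invisibleDomain_eq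
  refine ⟨⋃ t : ℝ, (fun p => (φ t p).1) ⁻¹' W,
    isOpen_iUnion fun t => hW.preimage (continuous_fst.comp (continuous_φ t)), ?_⟩
  ext p
  simp only [mem_flowout, mem_inter_iff, mem_iUnion, mem_preimage, e]
  constructor
  · rintro ⟨hp, t, ht, -⟩
    exact ⟨⟨t, ht⟩, hp⟩
  · rintro ⟨⟨t, ht⟩, hp⟩
    exact ⟨hp, t, ht, (φ_mem_T1 t hp).1⟩

theorem IsAcausalCircle.T1_eq (h : IsAcausalCircle Λ) :
    ∃ W : Set (V × V), IsOpen W ∧ T1 (invisibleDomain Λ) = W ∩ T1 AdS3 := by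
  obtain ⟨W, hW, e⟩ := h.invisibleDomain_eq
  refine ⟨Prod.fst ⁻¹' W, hW.preimage continuous_fst, ?_⟩
  ext p
  simp only [T1, e, mem_inter_iff, mem_preimage, mem_ofPred_eq]
  tauto

theorem φ_image_flowout (t : ℝ) : φ t '' flowout Λ = flowout Λ := by
  have key (s : ℝ) {p : V × V} (hp : p ∈ flowout Λ) : φ s p ∈ flowout Λ := by
    obtain ⟨r, y, hy, rfl⟩ := mem_iUnion.1 hp
    exact mem_iUnion.2 ⟨s + r, y, hy, φ_add s r y⟩
  refine Subset.antisymm (image_subset_iff.2 fun p hp => key t hp) fun p hp => ?_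
  exact ⟨φ (-t) p, key (-t) hp, φ_φ_neg t p⟩

theorem IsQuasiFuchsian.smul_image_flowout (h : IsQuasiFuchsian Γ Λ) {γ : GLV} (hγ : γ ∈ Γ) :
    (fun p => γ • p) '' flowout Λ = flowout Λ := by
  have key {g : GLV} (hg : g ∈ Γ) {p : V × V} (hp : p ∈ flowout Λ) : g • p ∈ flowout Λ :=
    (flowoutSub h).smul_mem ⟨g, hg⟩ hp
  refine Subset.antisymm (image_subset_iff.2 fun p hp => key hγ hp) fun p hp => ?_
  exact ⟨γ⁻¹ • p, key (Γ.inv_mem hγ) hp, smul_inv_smul γ p⟩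

/-- Orbits of points near a point of the flowout leave every bounded set of `ℝ⁴ × ℝ⁴`. -/
theorem IsQuasiFuchsian.exists_nhds_finite_flowout (h : IsQuasiFuchsian Γ Λ) {p : V × V}
    (hp : p ∈ flowout Λ) (R : ℝ) :
    ∃ U ∈ 𝓝 p, {γ : GLV | γ ∈ Γ ∧ ∃ y ∈ U, ‖γ • y‖ ≤ R}.Finite := by
  obtain ⟨-, t, ht⟩ := mem_flowout.1 hp
  -- The base point of `φ t (γ • y)` has coefficients `cosh t` and `sinh t` in the two components of
  -- `γ • y`, hence this radius.
  obtain ⟨U, hU, hfin⟩ := h.exists_nhds_finite ht ((|Real.cosh t| + |Real.sinh t|) * R)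
  refine ⟨(fun p => (φ t p).1) ⁻¹' U, (continuous_fst.comp (continuous_φ t)).continuousAt hU,
    hfin.subset ?_⟩
  rintro γ ⟨hγ, y, hy, hR⟩
  refine ⟨hγ, _, hy, ?_⟩
  have e : γ • (φ t y).1 = Real.cosh t • (γ • y).1 + Real.sinh t • (γ • y).2 := by
    change (γ • φ t y).1 = _
    rw [← φ_smul]
    rfl
  rw [e]
  refine (norm_add_le _ _).trans ?_
  rw [norm_smul, norm_smul, Real.norm_eq_abs, Real.norm_eq_abs, add_mul]
  exact add_le_add (mul_le_mul_of_nonneg_left ((norm_fst_le _).trans hR) (abs_nonneg _))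
    (mul_le_mul_of_nonneg_left ((norm_snd_le _).trans hR) (abs_nonneg _))

/-- `L` lies in a ball, and the compact set `K` is covered by finitely many of the neighbourhoods
from `exists_nhds_finite_flowout` for its radius. -/
theorem IsQuasiFuchsian.properlyDiscontinuous_flowout (h : IsQuasiFuchsian Γ Λ) :
    ActsProperlyDiscontinuouslyOn Γ (flowout Λ) := by
  intro K L hK hL hKc hLc
  obtain ⟨R, hR⟩ := hLc.isBounded.exists_norm_le
  have key : {γ : GLV | γ ∈ Γ ∧ ∃ y ∈ K, ‖γ • y‖ ≤ R}.Finite := by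
    refine hKc.induction_on (p := fun K => {γ : GLV | γ ∈ Γ ∧ ∃ y ∈ K, ‖γ • y‖ ≤ R}.Finite) ?_ ?_ ?_
      fun p hp => ?_
    · simp
    · intro s t hst ht
      exact ht.subset fun γ ⟨h1, y, h2, h3⟩ => ⟨h1, y, hst h2, h3⟩
    · intro s t hs ht
      refine (hs.union ht).subset ?_
      rintro γ ⟨h1, y, h2 | h2, h3⟩
      · exact Or.inl ⟨h1, y, h2, h3⟩
      · exact Or.inr ⟨h1, y, h2, h3⟩
    · obtain ⟨U, hU, hf⟩ := h.exists_nhds_finite_flowout (hK hp) R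
      exact ⟨U, mem_nhdsWithin_of_mem_nhds hU, hf⟩
  refine key.subset ?_
  rintro γ ⟨hγ, _, ⟨y, hy, rfl⟩, hyL⟩
  exact ⟨hγ, y, hy, hR _ hyL⟩

/-- An element of finite order has a fixed point in the convex core. -/
theorem IsQuasiFuchsian.eq_one_of_isOfFinOrder (h : IsQuasiFuchsian Γ Λ) {γ : GLV} (hγ : γ ∈ Γ)
    (hfin : IsOfFinOrder γ) : γ = 1 := by
  have hA := h.acausal
  obtain ⟨n, hn, hpow⟩ := isOfFinOrder_iff_pow_eq_one.1 hfin
  obtain ⟨ν₁, h₁, ν₂, h₂, hne⟩ := hA.exists_ne_mem_torusLift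
  have hcc : q (ν₁ + ν₂) (ν₁ + ν₂) < 0 := by
    rw [q_add_right]
    linarith [hA.q_add_neg h₁ h₂ hne h₁, hA.q_add_neg h₁ h₂ hne h₂]
  have hc : ν₁ + ν₂ ∈ hullCone Λ := (hullCone Λ).add_mem
      (torusLift_subset_hullCone h₁) (torusLift_subset_hullCone h₂)
  set c := ν₁ + ν₂
  -- Partial orbit sums stay timelike: each new term has norm `q c c < 0`, and vectors of the cone
  -- pair nonpositively.
  have key : ∀ m : ℕ, ∑ i ∈ Finset.range (m + 1), γ ^ i • c ∈ hullCone Λ ∧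
      q (∑ i ∈ Finset.range (m + 1), γ ^ i • c) (∑ i ∈ Finset.range (m + 1), γ ^ i • c) < 0 := by
    intro m
    induction m with
    | zero => simpa using ⟨hc, hcc⟩
    | succ m ih =>
      rw [Finset.sum_range_succ]
      have h1 := h.smul_mem_hullCone (Γ.pow_mem hγ (m + 1)) hc
      have h2 := q_smul h (Γ.pow_mem hγ (m + 1)) c c
      have h3 := hA.q_nonpos_hullCone ih.1 h1
      refine ⟨(hullCone Λ).add_mem ih.1 h1, ?_⟩
      rw [q_add_left, q_add_right, q_add_right, q_comm (γ ^ (m + 1) • c)]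
      linarith [ih.2]
  obtain ⟨m, rfl⟩ := Nat.exists_eq_succ_of_ne_zero hn.ne'
  obtain ⟨hd, hdq⟩ := key m
  refine h.free γ hγ _ (normalize_mem_convexCore hd hdq) ?_
  rw [glv_smul_smul]
  congr 1
  -- With `γ ^ (m + 1) = 1` the sum runs over a full period, so `γ` only permutes its terms
  -- cyclically.
  rw [Finset.smul_sum]
  simp only [← mul_smul, ← pow_succ']
  rw [Finset.sum_range_succ, Finset.sum_range_succ', hpow, pow_zero]

/-- All powers of an element fixing `p` move `p` within radius `‖p‖`, so there are finitely many of
them and the element has finite order. -/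
theorem IsQuasiFuchsian.free_flowout (h : IsQuasiFuchsian Γ Λ) :
    ActsFreelyOn Γ (flowout Λ) := by
  intro γ hγ p hp he
  refine h.eq_one_of_isOfFinOrder hγ ?_
  obtain ⟨U, hU, hfin⟩ := h.exists_nhds_finite_flowout hp ‖p‖
  refine finite_powers.1 (hfin.subset ?_)
  rintro _ ⟨n, rfl⟩
  refine ⟨Γ.pow_mem hγ n, p, mem_of_mem_nhds hU, ?_⟩
  have : γ ^ n • p = p := by
    induction n with
    | zero => simp
    | succ n ih => rw [pow_succ, mul_smul, he, ih]
  exact (congrArg norm this).le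

end AdS

/-! ### Submanifolds from slice charts -/

section Submanifold

variable {E F G : Type*} [NormedAddCommGroup E] [NormedSpace ℝ E] [NormedAddCommGroup F]
  [NormedSpace ℝ F] [NormedAddCommGroup G] [NormedSpace ℝ G]

/-- A submersion between finite-dimensional spaces is, in suitable local coordinates, a linear
projection. -/
theorem exists_openPartialHomeomorph_snd_eq [FiniteDimensional ℝ E] [FiniteDimensional ℝ F]
    [FiniteDimensional ℝ G] (hdim : Module.finrank ℝ E = Module.finrank ℝ G + Module.finrank ℝ F)
    {f : E → F} {f' : E →L[ℝ] F} {a : E} (hf : ContDiffAt ℝ ω f a) (hf' : HasFDerivAt f f' a)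
    (hsurj : f'.range = ⊤) :
    ∃ Φ : OpenPartialHomeomorph E (G × F), a ∈ Φ.source ∧ ContDiffOn ℝ ∞ Φ Φ.source ∧
      ContDiffOn ℝ ∞ Φ.symm Φ.target ∧ ∀ x, (Φ x).2 = f x := by
  have : CompleteSpace E := FiniteDimensional.complete ℝ E
  obtain ⟨p, hp⟩ := f'.ker_closedComplemented_of_finiteDimensional_range
  have hker : Module.finrank ℝ f'.ker = Module.finrank ℝ G := by
    have h1 := LinearMap.finrank_range_add_finrank_ker (f' : E →ₗ[ℝ] F)
    have h2 : Module.finrank ℝ (LinearMap.range (f' : E →ₗ[ℝ] F)) = Module.finrank ℝ F := by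
      rw [show LinearMap.range (f' : E →ₗ[ℝ] F) = ⊤ from hsurj, finrank_top]
    have h3 : Module.finrank ℝ f'.ker = Module.finrank ℝ (LinearMap.ker (f' : E →ₗ[ℝ] F)) := rfl
    omega
  let e : f'.ker ≃L[ℝ] G := ContinuousLinearEquiv.ofFinrankEq hker
  -- Completing `f'` by a projection onto its kernel gives an isomorphism, so the inverse function
  -- theorem applies to `g` below.
  let L : E →L[ℝ] G × F := ((e : f'.ker →L[ℝ] G).comp p).prod f'
  have hinj : Function.Injective (L : E →ₗ[ℝ] G × F) := by
    rw [← LinearMap.ker_eq_bot, LinearMap.ker_eq_bot']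
    intro x hx
    have h1 : e (p x) = 0 := congrArg Prod.fst hx
    have h2 : f' x = 0 := congrArg Prod.snd hx
    have h3 : p x = 0 := by simpa using h1
    have h4 := hp ⟨x, h2⟩
    simpa [h3] using congrArg Subtype.val h4.symm
  let L' : E ≃L[ℝ] G × F :=
    (LinearEquiv.ofInjectiveOfFinrankEq (L : E →ₗ[ℝ] G × F) hinj (by
      rw [hdim, Module.finrank_prod])).toContinuousLinearEquiv
  let g : E → G × F := fun x => (e (p x), f x)
  have hg : ContDiffAt ℝ ω g a :=
    ((e : f'.ker →L[ℝ] G).comp p).contDiff.contDiffAt.prodMk hf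
  have hg' : HasFDerivAt g (L' : E →L[ℝ] G × F) a := by
    have h1 : (L' : E →L[ℝ] G × F) = L := by ext x <;> rfl
    rw [h1]
    exact ((e : f'.ker →L[ℝ] G).comp p).hasFDerivAt.prodMk hf'
  let Ψ := hg.toOpenPartialHomeomorph g hg' (by simp)
  have hΨ : a ∈ Ψ.source := hg.mem_toOpenPartialHomeomorph_source hg' (by simp)
  -- Being `C^ω` at a point is an open condition, unlike being `C^∞` at a point in the pointwise
  -- sense, so `Φ` can be restricted to where it and its inverse are smooth.
  have hω : (ω : ℕ∞ω) ≠ ∞ := by simp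
  refine ⟨Ψ.restrContDiff ℝ ω hω, ⟨hΨ, hg, ?_⟩,
    (Ψ.contDiffOn_restrContDiff_source ℝ hω).of_le le_top,
    (Ψ.contDiffOn_restrContDiff_target ℝ hω).of_le le_top, fun x => rfl⟩
  refine Ψ.contDiffAt_symm (f₀' := L') (Ψ.map_source hΨ) ?_ ?_
  · rw [Ψ.left_inv hΨ]; exact hg'
  · rw [Ψ.left_inv hΨ]; exact hg

/-- The chart of a subset cut out by the vanishing of the second component of a local
homeomorphism. -/
noncomputable def sliceChart {S : Set E} (p : S) (Φ : OpenPartialHomeomorph E (G × F))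
    (hS : ∀ x ∈ Φ.source, x ∈ S ↔ (Φ x).2 = 0) : OpenPartialHomeomorph S G where
  toFun x := (Φ x).1
  -- The value `p` is a default; on the target the first branch always applies.
  invFun g := open scoped Classical in
    if h : Φ.symm (g, 0) ∈ S then ⟨Φ.symm (g, 0), h⟩ else p
  source := Subtype.val ⁻¹' Φ.source
  target := (fun g => (g, 0)) ⁻¹' Φ.target
  map_source' x hx := by
    have h1 : Φ x = ((Φ x).1, 0) := Prod.ext rfl ((hS x hx).1 x.2)
    rw [mem_preimage, ← h1]
    exact Φ.map_source hx
  map_target' g hg := by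
    have h1 : Φ.symm (g, 0) ∈ S := by
      rw [hS _ (Φ.map_target hg), Φ.right_inv hg]
    rw [dif_pos h1]
    exact Φ.map_target hg
  left_inv' x hx := by
    have h1 : ((Φ x).1, 0) = Φ x := Prod.ext rfl ((hS x hx).1 x.2).symm
    have h2 : Φ.symm ((Φ x).1, 0) = x := by rw [h1, Φ.left_inv hx]
    rw [dif_pos (by rw [h2]; exact x.2)]
    exact Subtype.ext h2
  right_inv' g hg := by
    have h1 : Φ.symm (g, 0) ∈ S := by
      rw [hS _ (Φ.map_target hg), Φ.right_inv hg]
    rw [dif_pos h1, Φ.right_inv hg]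
  open_source := Φ.open_source.preimage continuous_subtype_val
  open_target := Φ.open_target.preimage (Continuous.prodMk_left 0)
  continuousOn_toFun := continuous_fst.comp_continuousOn
    (Φ.continuousOn.comp continuous_subtype_val.continuousOn fun _ hx => hx)
  continuousOn_invFun := by
    rw [Topology.IsInducing.continuousOn_iff (Topology.IsInducing.subtypeVal (t := S))]
    refine (Φ.continuousOn_symm.comp (Continuous.prodMk_left (0 : F)).continuousOn
      fun _ hx => hx).congr fun g hg => ?_
    have h1 : Φ.symm (g, 0) ∈ S := by
      rw [hS _ (Φ.map_target hg), Φ.right_inv hg]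
    simp only [Function.comp_apply]
    rw [dif_pos h1]

omit [NormedSpace ℝ E] [NormedSpace ℝ F] [NormedSpace ℝ G] in
theorem sliceChart_symm_apply {S : Set E} (p : S) (Φ : OpenPartialHomeomorph E (G × F))
    (hS : ∀ x ∈ Φ.source, x ∈ S ↔ (Φ x).2 = 0) {g : G} (hg : g ∈ (sliceChart p Φ hS).target) :
    ((sliceChart p Φ hS).symm g : E) = Φ.symm (g, 0) := by
  have h1 : Φ.symm (g, 0) ∈ S := by
    rw [hS _ (Φ.map_target hg), Φ.right_inv hg]
  exact congrArg Subtype.val (dif_pos h1)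

/-- A subset of a normed space that is locally a slice of smooth coordinates is a smooth embedded
submanifold. -/
theorem exists_isSmoothEmbedding_of_slices (L : (G × F) ≃L[ℝ] E) {S : Set E}
    (h : ∀ x ∈ S, ∃ Φ : OpenPartialHomeomorph E (G × F), x ∈ Φ.source ∧
      ContDiffOn ℝ ∞ Φ Φ.source ∧ ContDiffOn ℝ ∞ Φ.symm Φ.target ∧
      ∀ y ∈ Φ.source, y ∈ S ↔ (Φ y).2 = 0) :
    ∃ _c : ChartedSpace G S, IsManifold 𝓘(ℝ, G) ∞ S ∧
      Manifold.IsSmoothEmbedding 𝓘(ℝ, G) 𝓘(ℝ, E) ∞ (Subtype.val : S → E) := by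
  choose Φ hx hΦ hΦs hS using fun x : S => h x x.2
  let ch (p : S) : OpenPartialHomeomorph S G := sliceChart p (Φ p) (hS p)
  let c : ChartedSpace G S :=
    { atlas := range ch
      chartAt := ch
      mem_chart_source := hx
      chart_mem_atlas := mem_range_self }
  have hmfd : IsManifold 𝓘(ℝ, G) ∞ S := by
    refine isManifold_of_contDiffOn _ _ _ ?_
    rintro _ _ ⟨p, rfl⟩ ⟨p', rfl⟩
    simp only [modelWithCornersSelf_coe, modelWithCornersSelf_coe_symm, range_id, inter_univ,
      Function.id_comp, Function.comp_id, preimage_id]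
    have h1 : ContDiffOn ℝ ∞ (fun g : G => (Φ p' ((Φ p).symm (g, 0))).1)
        ((ch p).symm ≫ₕ ch p').source := by
      refine contDiff_fst.comp_contDiffOn ((hΦ p').comp ((hΦs p).comp
        (contDiff_prodMk_left (0 : F)).contDiffOn fun g hg => hg.1) fun g hg => ?_)
      have := sliceChart_symm_apply p (Φ p) (hS p) hg.1
      change (Φ p).symm (g, 0) ∈ (Φ p').source
      rw [← this]
      exact hg.2
    refine h1.congr fun g hg => ?_
    change (Φ p' ((ch p).symm g)).1 = _
    rw [sliceChart_symm_apply p (Φ p) (hS p) hg.1]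
  refine ⟨c, hmfd, ⟨?_, Topology.IsEmbedding.subtypeVal⟩⟩
  refine Manifold.IsImmersionOfComplement.isImmersion (F := F) fun p => ?_
  -- In the slice chart and the ambient chart `Φ p` followed by `L`, the inclusion reads `g ↦ L (g,
  -- 0)`.
  refine Manifold.IsImmersionAtOfComplement.mk_of_charts L (ch p)
    ((Φ p).trans L.toHomeomorph.toOpenPartialHomeomorph) (hx p) (by simpa using hx p)
    (StructureGroupoid.subset_maximalAtlas _ ⟨p, rfl⟩) ?_ ?_ ?_
  · refine (contDiffGroupoid ∞ 𝓘(ℝ, E)).mem_maximalAtlas_of_mem_groupoid ?_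
    rw [contDiffGroupoid, mem_groupoid_of_pregroupoid]
    constructor
    · simp only [contDiffPregroupoid, modelWithCornersSelf_coe, modelWithCornersSelf_coe_symm,
        range_id, inter_univ, Function.id_comp, Function.comp_id, preimage_id]
      exact L.contDiff.comp_contDiffOn ((hΦ p).mono fun x hx => hx.1)
    · simp only [contDiffPregroupoid, modelWithCornersSelf_coe, modelWithCornersSelf_coe_symm,
        range_id, inter_univ, Function.id_comp, Function.comp_id, preimage_id]
      exact (hΦs p).comp L.symm.contDiff.contDiffOn fun x hx => hx.2
  · intro x hx
    exact ⟨hx, mem_univ _⟩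
  · intro g hg
    have hg : g ∈ (ch p).target := by simpa using hg
    have h1 := sliceChart_symm_apply p (Φ p) (hS p) hg
    simp only [OpenPartialHomeomorph.extend_coe, OpenPartialHomeomorph.extend_coe_symm,
      modelWithCornersSelf_coe, modelWithCornersSelf_coe_symm, Function.comp_apply, id_eq]
    change L (Φ p ((ch p).symm g)) = _
    rw [h1, (Φ p).right_inv hg]

end Submanifold

/-! ### `T1 AdS3` as a regular level set -/

namespace AdS

/-- The form `q` as a continuous bilinear map. -/
noncomputable def qL : V →L[ℝ] V →L[ℝ] ℝ :=
  (LinearMap.mk₂ ℝ q q_add_left q_smul_left q_add_right q_smul_right).mkContinuous₂ 4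
    fun x y => by
      rw [LinearMap.mk₂_apply, Real.norm_eq_abs, mul_assoc]
      exact abs_q_le x y

theorem qL_apply (x y : V) : qL x y = q x y := rfl

/-- The defining function of `T¹AdS₃ ⊆ ℝ⁴ × ℝ⁴`. -/
def constraint (p : V × V) : ℝ × ℝ × ℝ := (q p.1 p.1 + 1, q p.1 p.2, q p.2 p.2 - 1)

theorem constraint_eq_zero {p : V × V} : constraint p = 0 ↔ p ∈ T1 AdS3 := by
  simp only [constraint, Prod.ext_iff, Prod.fst_zero, Prod.snd_zero, T1, AdS3, mem_ofPred_eq,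
    sub_eq_zero, add_eq_zero_iff_eq_neg]

/-- At `(x, v)` the derivative sends `(x, 0)`, `(v, 0)`, `(0, v)` to `(-2, 0, 0)`, `(0, 1, 0)`, `(0,
0, 2)`, since `x` and `v` are `q`-orthogonal of norms `-1` and `1`. -/
theorem exists_hasFDerivAt_constraint {p : V × V} (hp : p ∈ T1 AdS3) :
    ∃ f' : V × V →L[ℝ] ℝ × ℝ × ℝ, HasFDerivAt constraint f' p ∧ f'.range = ⊤ := by
  obtain ⟨h1, h2, h3⟩ := hp
  have h1 : q p.1 p.1 = -1 := h1
  have h4 : q p.2 p.1 = 0 := (q_comm _ _).trans h2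
  have d1 : HasFDerivAt (fun p : V × V => p.1) (ContinuousLinearMap.fst ℝ V V) p := hasFDerivAt_fst
  have d2 : HasFDerivAt (fun p : V × V => p.2) (ContinuousLinearMap.snd ℝ V V) p := hasFDerivAt_snd
  refine ⟨_, ((qL.hasFDerivAt_of_bilinear d1 d1).add_const 1).prodMk
    ((qL.hasFDerivAt_of_bilinear d1 d2).prodMk
      ((qL.hasFDerivAt_of_bilinear d2 d2).sub_const 1)), ?_⟩
  refine LinearMap.range_eq_top.2 fun ⟨a, b, c⟩ => ⟨(-(a / 2)) • (p.1, 0) + b • (p.2, 0)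
    + (c / 2) • (0, p.2), ?_⟩
  simp only [ContinuousLinearMap.coe_coe, ContinuousLinearMap.prod_apply,
    add_apply, ContinuousLinearMap.precompR_apply,
    ContinuousLinearMap.precompL_apply, ContinuousLinearMap.compL_apply,
    ContinuousLinearMap.comp_apply, ContinuousLinearMap.coe_fst',
    ContinuousLinearMap.coe_snd', qL_apply, Prod.fst_add, Prod.snd_add, Prod.smul_mk, smul_zero,
    add_zero, zero_add, q_add_left, q_add_right, q_smul_left, q_smul_right, h1, h2, h3, h4,
    Prod.mk.injEq]
  refine ⟨?_, ?_, ?_⟩ <;> ring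

theorem contDiff_constraint {n : ℕ∞ω} : ContDiff ℝ n constraint := by
  unfold constraint q
  fun_prop

/-- A relatively open subset of `T¹AdS₃` is a smooth embedded five-dimensional submanifold. -/
theorem exists_isSmoothEmbedding {S : Set (V × V)}
    (hS : ∃ W : Set (V × V), IsOpen W ∧ S = W ∩ T1 AdS3) :
    ∃ _c : ChartedSpace E5 S, IsManifold 𝓘(ℝ, E5) ∞ S ∧
      Manifold.IsSmoothEmbedding 𝓘(ℝ, E5) 𝓘(ℝ, V × V) ∞ (Subtype.val : S → V × V) := by
  obtain ⟨W, hW, rfl⟩ := hS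
  have hdim : Module.finrank ℝ (V × V) =
      Module.finrank ℝ E5 + Module.finrank ℝ (ℝ × ℝ × ℝ) := by simp
  have L : (E5 × (ℝ × ℝ × ℝ)) ≃L[ℝ] V × V :=
    ContinuousLinearEquiv.ofFinrankEq (by rw [hdim, Module.finrank_prod])
  refine exists_isSmoothEmbedding_of_slices L fun p hp => ?_
  obtain ⟨f', hf', hsurj⟩ := exists_hasFDerivAt_constraint hp.2
  obtain ⟨Φ, hpΦ, h1, h2, h3⟩ := exists_openPartialHomeomorph_snd_eq hdim
    contDiff_constraint.contDiffAt hf' hsurj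
  refine ⟨Φ.restrOpen W hW, ⟨hpΦ, hp.1⟩, h1.mono fun x hx => hx.1, h2.mono fun x hx => hx.1, ?_⟩
  intro x hx
  have : (Φ.restrOpen W hW x).2 = constraint x := h3 x
  rw [this, constraint_eq_zero]
  exact ⟨fun h => h.2, fun h => ⟨hx.2, h⟩⟩

end AdS

/-! ### Smooth structures on quotients, and local diffeomorphisms -/

section Quotient

variable {G : Type*} [NormedAddCommGroup G] [NormedSpace ℝ G]
  {X Y : Type*} [TopologicalSpace X] [TopologicalSpace Y] [ChartedSpace G X]

/-- A surjective local homeomorphism whose fibres are related by smooth deck transformations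
induces a smooth structure on its target, for which it is a local diffeomorphism. -/
theorem IsLocalHomeomorph.isManifold_and_isLocalDiffeomorph [IsManifold 𝓘(ℝ, G) ∞ X] {π : X → Y}
    (hπ : IsLocalHomeomorph π) (hs : Function.Surjective π)
    (hdeck : ∀ x x', π x = π x' → ∃ τ : X → X, ContMDiff 𝓘(ℝ, G) 𝓘(ℝ, G) ∞ τ ∧ τ x = x' ∧
      ∀ z, π (τ z) = π z) :
    let _ := hπ.chartedSpace (H := G) hs
    IsManifold 𝓘(ℝ, G) ∞ Y ∧ IsLocalDiffeomorph 𝓘(ℝ, G) 𝓘(ℝ, G) ∞ π := by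
  let _ := hπ.chartedSpace (H := G) hs
  let g : Y → X := hs.hasRightInverse.choose
  have hg : ∀ y, π (g y) = y := hs.hasRightInverse.choose_spec
  have hsym (x a : X) : (hπ.localInverseAt x).symm a = π a :=
    congrFun (hπ.localInverseAt_symm x) a
  have hchart (y : Y) : chartAt G y = (hπ.localInverseAt (g y)).trans (chartAt G (g y)) := rfl
  -- two local inverses differ by a deck transformation
  have hdiff (x : X) {y : Y} (hy : y ∈ (hπ.localInverseAt x).source) (a : X) (ha : π a = y) :
      ∃ τ : X → X, ContMDiff 𝓘(ℝ, G) 𝓘(ℝ, G) ∞ τ ∧ τ a = hπ.localInverseAt x y ∧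
        (∀ z, π (τ z) = π z) ∧ ∀ᶠ a' in 𝓝 a, hπ.localInverseAt x (π a') = τ a' := by
    obtain ⟨τ, hτ, hτa, hπτ⟩ := hdeck a (hπ.localInverseAt x y) (by
      rw [ha, hπ.apply_localInverseAt_of_mem hy])
    refine ⟨τ, hτ, hτa, hπτ, ?_⟩
    have : (hπ.localInverseAt x).target ∈ 𝓝 (τ a) := by
      rw [hτa]
      exact (hπ.localInverseAt x).open_target.mem_nhds ((hπ.localInverseAt x).map_source hy)
    filter_upwards [hτ.continuous.continuousAt this] with a' ha'
    rw [← hπτ a', ← hsym x, (hπ.localInverseAt x).right_inv ha']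
  have hmfd : IsManifold 𝓘(ℝ, G) ∞ Y := by
    refine isManifold_of_contDiffOn _ _ _ ?_
    rintro _ _ ⟨y₁, rfl⟩ ⟨y₂, rfl⟩
    simp only [modelWithCornersSelf_coe, modelWithCornersSelf_coe_symm, range_id, inter_univ,
      Function.id_comp, Function.comp_id, preimage_id]
    change ContDiffOn ℝ ∞ _ (((hπ.localInverseAt (g y₁)).trans (chartAt G (g y₁))).symm ≫ₕ
      (hπ.localInverseAt (g y₂)).trans (chartAt G (g y₂))).source
    intro z hz
    have hz1 : z ∈ (chartAt G (g y₁)).target := hz.1.1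
    have hz2 : (hπ.localInverseAt (g y₁)).symm ((chartAt G (g y₁)).symm z) ∈
      (hπ.localInverseAt (g y₂)).source := hz.2.1
    have hz3 : hπ.localInverseAt (g y₂) ((hπ.localInverseAt (g y₁)).symm
      ((chartAt G (g y₁)).symm z)) ∈ (chartAt G (g y₂)).source := hz.2.2
    rw [hsym] at hz2 hz3
    -- Near `z` the transition map is a deck transformation read in charts of `X`, hence smooth.
    obtain ⟨τ, hτ, hτa, -, hev⟩ := hdiff (g y₂) hz2 _ rfl
    rw [← hτa] at hz3
    have c1 := contMDiffAt_symm_of_mem_maximalAtlas (I := 𝓘(ℝ, G)) (n := ∞)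
      (IsManifold.chart_mem_maximalAtlas (g y₁)) hz1
    have c2 := contMDiffAt_of_mem_maximalAtlas (I := 𝓘(ℝ, G)) (n := ∞)
      (IsManifold.chart_mem_maximalAtlas (g y₂)) hz3
    have c3 := ((c2.comp _ hτ.contMDiffAt).comp z c1).contDiffAt
    refine (c3.congr_of_eventuallyEq ?_).contDiffWithinAt
    filter_upwards [c1.continuousAt.eventually hev] with w hw
    change chartAt G (g y₂) (hπ.localInverseAt (g y₂) ((hπ.localInverseAt (g y₁)).symm
      ((chartAt G (g y₁)).symm w))) = _
    rw [hsym, hw]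
    rfl
  refine ⟨hmfd, ?_⟩
  have hgl (y : Y) : ContMDiffAt 𝓘(ℝ, G) 𝓘(ℝ, G) ∞ (hπ.localInverseAt (g y)) y := by
    have hy : y ∈ (chartAt G y).source := mem_chart_source G y
    have c1 := contMDiffAt_of_mem_maximalAtlas (I := 𝓘(ℝ, G)) (n := ∞)
      (IsManifold.chart_mem_maximalAtlas y) hy
    have c2 := contMDiffAt_symm_of_mem_maximalAtlas (I := 𝓘(ℝ, G)) (n := ∞)
      (IsManifold.chart_mem_maximalAtlas (g y)) (x := chartAt G y y)
      ((chartAt G (g y)).map_source hy.2)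
    refine (c2.comp _ c1).congr_of_eventuallyEq ?_
    filter_upwards [(chartAt G y).open_source.mem_nhds hy] with y' hy'
    exact ((chartAt G (g y)).left_inv hy'.2).symm
  have hgπ (y : Y) : ContMDiffAt 𝓘(ℝ, G) 𝓘(ℝ, G) ∞ π (g y) := by
    have hy : y ∈ (chartAt G y).source := mem_chart_source G y
    have e : hπ.localInverseAt (g y) y = g y := by
      have := hπ.localInverseAt_apply_self (x := g y)
      rwa [hg] at this
    have e' : chartAt G y y = chartAt G (g y) (g y) := congrArg (chartAt G (g y)) e
    have c1 := contMDiffAt_of_mem_maximalAtlas (I := 𝓘(ℝ, G)) (n := ∞)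
      (IsManifold.chart_mem_maximalAtlas (g y)) (mem_chart_source G (g y))
    have c2 := contMDiffAt_symm_of_mem_maximalAtlas (I := 𝓘(ℝ, G)) (n := ∞)
      (IsManifold.chart_mem_maximalAtlas y) (x := chartAt G (g y) (g y))
      (e' ▸ (chartAt G y).map_source hy)
    refine (c2.comp _ c1).congr_of_eventuallyEq ?_
    filter_upwards [(chartAt G (g y)).open_source.mem_nhds (mem_chart_source G (g y))] with a ha
    change π a = (hπ.localInverseAt (g y)).symm
      ((chartAt G (g y)).symm (chartAt G (g y) a))
    rw [(chartAt G (g y)).left_inv ha, hsym]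
  intro x
  refine ⟨⟨(hπ.localInverseAt x).symm.toPartialEquiv, (hπ.localInverseAt x).open_target,
    (hπ.localInverseAt x).open_source, ?_, ?_⟩, hπ.self_mem_localInverseAt_target,
    fun a _ => (hsym x a).symm⟩
  · have : ContMDiff 𝓘(ℝ, G) 𝓘(ℝ, G) ∞ π := by
      intro a
      -- The charts of `Y` are built at the chosen preimages `g y`, where `π` is smooth by `hgπ`; a
      -- deck transformation carries `a` to such a preimage.
      obtain ⟨τ, hτ, hτa, hπτ⟩ := hdeck a (g (π a)) (hg _).symm
      have h1 : π = π ∘ τ := funext fun z => (hπτ z).symm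
      rw [h1]
      refine ContMDiffAt.comp _ ?_ hτ.contMDiffAt
      rw [hτa]
      exact hgπ _
    exact this.contMDiffOn.congr fun a _ => hsym x a
  · intro y hy
    obtain ⟨τ, hτ, hτa, hπτ, hev⟩ := hdiff x (y := y) hy (g y) (hg y)
    have e : hπ.localInverseAt (g y) y = g y := by
      have := hπ.localInverseAt_apply_self (x := g y)
      rwa [hg] at this
    refine ContMDiffAt.contMDiffWithinAt ?_
    have c := hτ.contMDiffAt.comp y (hgl y)
    refine c.congr_of_eventuallyEq ?_
    have hys : (hπ.localInverseAt (g y)).source ∈ 𝓝 y :=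
      (hπ.localInverseAt (g y)).open_source.mem_nhds (by
        have := hπ.apply_self_mem_localInverseAt_source (x := g y)
        rwa [hg] at this)
    have hev' := (hgl y).continuousAt.eventually (by rw [e]; exact hev)
    filter_upwards [hev', hys] with y' h1 h2
    rw [hπ.apply_localInverseAt_of_mem h2] at h1
    exact h1

end Quotient

section LocalDiffeomorph

variable {E₁ E₂ E₃ : Type*} [NormedAddCommGroup E₁] [NormedSpace ℝ E₁] [NormedAddCommGroup E₂]
  [NormedSpace ℝ E₂] [NormedAddCommGroup E₃] [NormedSpace ℝ E₃]
  {X Y Z : Type*} [TopologicalSpace X] [TopologicalSpace Y] [TopologicalSpace Z]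
  [ChartedSpace E₁ X] [ChartedSpace E₂ Y] [ChartedSpace E₃ Z]

/-- Near `π x`, `f` is `f ∘ π` preceded by a local inverse of `π`. -/
theorem IsLocalDiffeomorphAt.of_comp_right {n : ℕ∞ω} {π : X → Y} {f : Y → Z} {x : X}
    (hπ : IsLocalDiffeomorphAt 𝓘(ℝ, E₁) 𝓘(ℝ, E₂) n π x)
    (h : IsLocalDiffeomorphAt 𝓘(ℝ, E₁) 𝓘(ℝ, E₃) n (f ∘ π) x) :
    IsLocalDiffeomorphAt 𝓘(ℝ, E₂) 𝓘(ℝ, E₃) n f (π x) := by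
  have hx : hπ.localInverse (π x) = x := hπ.localInverse_left_inv hπ.localInverse_mem_target
  obtain ⟨Ψ, hΨ, he⟩ := h
  refine ⟨hπ.localInverse.trans Ψ, ⟨hπ.localInverse_mem_source, ?_⟩, fun y hy => ?_⟩
  · change hπ.localInverse (π x) ∈ Ψ.source
    rwa [hx]
  · have h1 : hπ.localInverse y ∈ Ψ.source := hy.2
    have h2 := he h1
    rw [Function.comp_apply, hπ.localInverse_right_inv hy.1] at h2
    exact h2

/-- Smoothness of a family of maps out of `Y` can be checked after composing with a surjective
local diffeomorphism onto `Y`. -/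
theorem IsLocalDiffeomorph.contMDiff_prod_of_comp {n : ℕ∞ω} {π : X → Y}
    (hπ : IsLocalDiffeomorph 𝓘(ℝ, E₁) 𝓘(ℝ, E₂) n π) (hs : Function.Surjective π)
    {f : ℝ × Y → Z} (hf : ContMDiff (𝓘(ℝ, ℝ).prod 𝓘(ℝ, E₁)) 𝓘(ℝ, E₃) n
      fun a : ℝ × X => f (a.1, π a.2)) :
    ContMDiff (𝓘(ℝ, ℝ).prod 𝓘(ℝ, E₂)) 𝓘(ℝ, E₃) n f := by
  rintro ⟨t, y⟩
  obtain ⟨x, rfl⟩ := hs y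
  have h1 : ContMDiffAt (𝓘(ℝ, ℝ).prod 𝓘(ℝ, E₂)) (𝓘(ℝ, ℝ).prod 𝓘(ℝ, E₁)) n
      (fun a : ℝ × Y => (a.1, (hπ x).localInverse a.2)) (t, π x) :=
    contMDiffAt_fst.prodMk (ContMDiffAt.comp (t, π x) (hπ x).localInverse_contMDiffAt
      contMDiffAt_snd)
  refine (ContMDiffAt.comp (t, π x) hf.contMDiffAt h1).congr_of_eventuallyEq ?_
  have h2 : ∀ᶠ y in 𝓝 (π x), π ((hπ x).localInverse y) = y :=
    (hπ x).localInverse_eventuallyEq_right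
  filter_upwards [(continuous_snd.tendsto (t, π x)).eventually h2] with a ha
  change f a = f (a.1, π ((hπ x).localInverse a.2))
  rw [ha]

end LocalDiffeomorph

section Inclusion

variable {E G : Type*} [NormedAddCommGroup E] [NormedSpace ℝ E] [NormedAddCommGroup G]
  [NormedSpace ℝ G]

/-- The inclusion of a relatively open subset of a submanifold is a local diffeomorphism. -/
theorem isLocalDiffeomorph_inclusion {S T : Set E} [ChartedSpace G S] [ChartedSpace G T]
    [IsManifold 𝓘(ℝ, G) ∞ S] [IsManifold 𝓘(ℝ, G) ∞ T]
    (hS : Manifold.IsSmoothEmbedding 𝓘(ℝ, G) 𝓘(ℝ, E) ∞ (Subtype.val : S → E))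
    (hT : Manifold.IsSmoothEmbedding 𝓘(ℝ, G) 𝓘(ℝ, E) ∞ (Subtype.val : T → E))
    (hST : S ⊆ T) (hopen : IsOpen {x : T | (x : E) ∈ S}) :
    IsLocalDiffeomorph 𝓘(ℝ, G) 𝓘(ℝ, G) ∞ (inclusion hST) := by
  classical
  intro x
  let inv : T → S := fun y => if h : (y : E) ∈ S then ⟨y, h⟩ else x
  have hval : ∀ y : T, (y : E) ∈ S → (inv y : E) = y := fun y hy => by
    simp only [inv, dif_pos hy]
  refine ⟨⟨⟨inclusion hST, inv, univ, {y : T | (y : E) ∈ S}, fun y _ => y.2, fun _ _ => trivial,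
    fun y _ => Subtype.ext (hval _ y.2), fun y hy => Subtype.ext (hval _ hy)⟩, isOpen_univ, hopen,
    ?_, ?_⟩, mem_univ _, fun _ _ => rfl⟩
  · refine ContMDiff.contMDiffOn ?_
    -- A continuous map into an immersed manifold is smooth once it is smooth in the ambient space,
    -- where both directions become the identity on points.
    rw [ContMDiff.iff_comp_isImmersion hT.isImmersion]
    exact ⟨continuous_inclusion hST, hS.contMDiff⟩
  · intro y hy
    refine ContMDiffAt.contMDiffWithinAt ?_
    have hev : Subtype.val ∘ inv =ᶠ[𝓝 y] (Subtype.val : T → E) := by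
      filter_upwards [hopen.mem_nhds hy] with z hz using hval z hz
    rw [ContMDiffAt.iff_comp_isImmersionAt (hS.isImmersion.isImmersionAt _)]
    refine ⟨?_, hT.contMDiff.contMDiffAt.congr_of_eventuallyEq hev⟩
    rw [Topology.IsInducing.subtypeVal.continuousAt_iff]
    exact continuous_subtype_val.continuousAt.congr hev.symm

end Inclusion

/-! ### The quotients by `Γ` and the induced flow -/

namespace AdS

variable {Γ : Subgroup GLV} {Λ : Set (Module.Ray ℝ V)}

theorem contDiff_glv_smul {n : ℕ∞ω} (γ : GLV) : ContDiff ℝ n fun p : V × V => γ • p :=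
  ((γ : V →L[ℝ] V).contDiff.comp contDiff_fst).prodMk
    ((γ : V →L[ℝ] V).contDiff.comp contDiff_snd)

theorem isClosed_T1 : IsClosed (T1 AdS3) := by
  have h : T1 AdS3 = constraint ⁻¹' {0} := by
    ext p
    exact constraint_eq_zero.symm
  rw [h]
  exact isClosed_singleton.preimage (contDiff_constraint (n := 0)).continuous

section SubMulAction

variable (S : SubMulAction Γ (V × V))

instance smulSub : SMul Γ S := (inferInstance : MulAction Γ S).toSMul

theorem continuousConstSMul_sub : ContinuousConstSMul Γ S where
  continuous_const_smul γ := by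
    rw [Topology.IsInducing.subtypeVal.continuous_iff]
    exact (contDiff_glv_smul (n := 0) (γ : GLV)).continuous.comp continuous_subtype_val

variable {S}

theorem locallyCompactSpace_sub (hS : ∃ W : Set (V × V), IsOpen W ∧ (S : Set (V × V)) =
    W ∩ T1 AdS3) : LocallyCompactSpace S := by
  obtain ⟨W, hW, e⟩ := hS
  have : IsLocallyClosed (S : Set (V × V)) := by
    rw [e]
    exact hW.isLocallyClosed.inter isClosed_T1.isLocallyClosed
  exact this.locallyCompactSpace

theorem properlyDiscontinuousSMul_sub (h : ActsProperlyDiscontinuouslyOn Γ (S : Set (V × V))) :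
    ProperlyDiscontinuousSMul Γ S where
  finite_disjoint_inter_image := by
    intro K L hK hL
    have := h (Subtype.val '' K) (Subtype.val '' L) (by rintro _ ⟨x, -, rfl⟩; exact x.2)
      (by rintro _ ⟨x, -, rfl⟩; exact x.2) (hK.image continuous_subtype_val)
      (hL.image continuous_subtype_val)
    refine (this.preimage (f := Subtype.val) Subtype.val_injective.injOn).subset ?_
    rintro γ ⟨_, ⟨x, hx, rfl⟩, hL⟩
    exact ⟨γ.2, _, ⟨x, ⟨x, hx, rfl⟩, rfl⟩, _, hL, rfl⟩

theorem isCancelSMul_sub (h : ActsFreelyOn Γ (S : Set (V × V))) : IsCancelSMul Γ S := by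
  rw [isCancelSMul_iff_eq_one_of_smul_eq]
  intro γ x hx
  exact Subtype.ext (h γ γ.2 x x.2 (congrArg Subtype.val hx))

theorem isOpenQuotientMap_proj : IsOpenQuotientMap (proj S) :=
  have := continuousConstSMul_sub S
  MulAction.isOpenQuotientMap_quotientMk

theorem proj_eq_proj {x y : S} : proj S x = proj S y ↔ ∃ γ : Γ, γ • y = x :=
  Quotient.eq''

/-- The quotient of a relatively open subset of `T¹AdS₃` by a free and properly discontinuous
action is a smooth manifold. -/
theorem exists_quotientStructure (hS : ∃ W : Set (V × V), IsOpen W ∧ (S : Set (V × V)) =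
    W ∩ T1 AdS3) (hfree : ActsFreelyOn Γ (S : Set (V × V)))
    (hpd : ActsProperlyDiscontinuouslyOn Γ (S : Set (V × V))) :
    ∃ (_c : ChartedSpace E5 (Quo S)) (_cS : ChartedSpace E5 S),
      IsManifold 𝓘(ℝ, E5) ∞ (Quo S) ∧ IsManifold 𝓘(ℝ, E5) ∞ S ∧
      Manifold.IsSmoothEmbedding 𝓘(ℝ, E5) 𝓘(ℝ, V × V) ∞ (Subtype.val : S → V × V) ∧
      IsLocalDiffeomorph 𝓘(ℝ, E5) 𝓘(ℝ, E5) ∞ (proj S) := by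
  have := continuousConstSMul_sub S
  have := locallyCompactSpace_sub hS
  have := properlyDiscontinuousSMul_sub hpd
  have := isCancelSMul_sub hfree
  have hloc : IsLocalHomeomorph (proj S) :=
    (isQuotientCoveringMap_quotientMk_of_properlyDiscontinuousSMul
      (G := Γ) (E := S)).isCoveringMap.isLocalHomeomorph
  have hsurj : Function.Surjective (proj S) := isOpenQuotientMap_proj.surjective
  obtain ⟨cS, hm, he⟩ := exists_isSmoothEmbedding hS
  have hm' : IsManifold 𝓘(ℝ, E5) ∞ S := hm
  obtain ⟨h1, h2⟩ := hloc.isManifold_and_isLocalDiffeomorph (G := E5) hsurj fun x x' hx => by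
    obtain ⟨γ, hγ⟩ := proj_eq_proj.1 hx.symm
    refine ⟨fun z => γ • z, ?_, hγ, fun z => proj_eq_proj.2 ⟨γ, rfl⟩⟩
    refine (ContMDiff.iff_comp_isImmersion he.isImmersion).2 ⟨continuous_const_smul γ, ?_⟩
    exact (contDiff_glv_smul (γ : GLV)).contMDiff.comp he.contMDiff
  exact ⟨_, cS, h1, hm', he, h2⟩

end SubMulAction

theorem T1_subset_flowout : T1 (invisibleDomain Λ) ⊆ flowout Λ := fun p hp =>
  mem_flowout.2 ⟨T1_invisibleDomain hp, 0, by rw [φ_zero]; exact hp.1⟩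

theorem inclQuo_proj (h : IsQuasiFuchsian Γ Λ) (p : tangentSub h) :
    inclQuo h (proj _ p) = proj (flowoutSub h) (inclusion T1_subset_flowout p) := rfl

theorem injective_inclQuo (h : IsQuasiFuchsian Γ Λ) : Function.Injective (inclQuo h) := by
  intro a b hab
  obtain ⟨x, rfl⟩ := isOpenQuotientMap_proj.surjective a
  obtain ⟨y, rfl⟩ := isOpenQuotientMap_proj.surjective b
  rw [inclQuo_proj, inclQuo_proj, proj_eq_proj] at hab
  obtain ⟨γ, hγ⟩ := hab
  exact proj_eq_proj.2 ⟨γ, Subtype.ext (congrArg (fun z : flowoutSub h => z.1) hγ)⟩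

/-- The flow induced by the geodesic flow on the quotient of the flowout. -/
noncomputable def quotientFlow (h : IsQuasiFuchsian Γ Λ) : Flow ℝ (Quo (flowoutSub h)) where
  toFun t := Quotient.map (flowoutFlow h t) (by
    rintro a b ⟨γ, hγ⟩
    refine ⟨γ, Subtype.ext ?_⟩
    rw [← hγ]
    exact (φ_smul t γ b).symm)
  cont' := by
    -- A product with a quotient map need not be a quotient map, but openness of the projection
    -- makes it one here.
    have hq : IsOpenQuotientMap (Prod.map id (proj (flowoutSub h)) : ℝ × _ → ℝ × _) :=
      IsOpenQuotientMap.id.prodMap isOpenQuotientMap_proj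
    rw [hq.isQuotientMap.continuous_iff]
    refine isOpenQuotientMap_proj.continuous.comp (f := fun a : ℝ × flowoutSub h =>
      flowoutFlow h a.1 a.2) ?_
    exact ((contDiff_φ (n := 0)).continuous.comp
      (continuous_fst.prodMk (continuous_subtype_val.comp continuous_snd))).subtype_mk _
  map_add' s t x := by
    obtain ⟨p, rfl⟩ := isOpenQuotientMap_proj.surjective x
    exact congrArg (proj (flowoutSub h)) (Subtype.ext (φ_add s t p))
  map_zero' x := by
    obtain ⟨p, rfl⟩ := isOpenQuotientMap_proj.surjective x
    exact congrArg (proj (flowoutSub h)) (Subtype.ext (φ_zero p))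

theorem quotientFlow_proj (h : IsQuasiFuchsian Γ Λ) (t : ℝ) (p : flowoutSub h) :
    quotientFlow h t (proj _ p) = proj _ (flowoutFlow h t p) := rfl

end AdS

end

theorem mainTheorem7 (Γ : Subgroup AdS.GLV) (Λ : Set (Module.Ray ℝ AdS.V))
    (h : AdS.IsQuasiFuchsian Γ Λ) :
    -- the two descriptions of the flowout, which is an open subset of `T¹AdS₃`,
    -- invariant under the flow and under `Γ`
    AdS.flowout Λ = {p | p ∈ AdS.T1 AdS.AdS3 ∧ ∃ t : ℝ, (AdS.φ t p).1 ∈ AdS.invisibleDomain Λ} ∧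
    (∃ W : Set (AdS.V × AdS.V), IsOpen W ∧ AdS.flowout Λ = W ∩ AdS.T1 AdS.AdS3) ∧
    (∀ t : ℝ, AdS.φ t '' AdS.flowout Λ = AdS.flowout Λ) ∧
    (∀ γ ∈ Γ, (fun p => γ • p) '' AdS.flowout Λ = AdS.flowout Λ) ∧
    -- the action of `Γ` on the flowout
    AdS.ActsFreelyOn Γ (AdS.flowout Λ) ∧
    AdS.ActsProperlyDiscontinuouslyOn Γ (AdS.flowout Λ) ∧
    -- the quotient `ℳ` is a smooth manifold that contains `T¹M` as an open submanifold,
    -- and the flow descends to a complete smooth flow on it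
    T2Space (AdS.Quo (AdS.flowoutSub h)) ∧
    SecondCountableTopology (AdS.Quo (AdS.flowoutSub h)) ∧
    ∃ (c : ChartedSpace AdS.E5 (AdS.Quo (AdS.flowoutSub h)))
      (c' : ChartedSpace AdS.E5 (AdS.Quo (AdS.tangentSub h))),
      AdS.IsQuotientStructure (AdS.flowoutSub h) c ∧
      AdS.IsQuotientStructure (AdS.tangentSub h) c' ∧
      Topology.IsOpenEmbedding (AdS.inclQuo h) ∧
      IsLocalDiffeomorph 𝓘(ℝ, AdS.E5) 𝓘(ℝ, AdS.E5) ∞ (AdS.inclQuo h) ∧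
      ∃ Ψ : Flow ℝ (AdS.Quo (AdS.flowoutSub h)),
        (∀ (t : ℝ) (p : AdS.flowoutSub h),
          Ψ t (AdS.proj (AdS.flowoutSub h) p) =
            AdS.proj (AdS.flowoutSub h) (AdS.flowoutFlow h t p)) ∧
        ContMDiff (𝓘(ℝ, ℝ).prod 𝓘(ℝ, AdS.E5)) 𝓘(ℝ, AdS.E5) ∞
          (fun a : ℝ × AdS.Quo (AdS.flowoutSub h) => Ψ a.1 a.2) := by
  have hW := h.acausal.flowout_eq
  have hfree := h.free_flowout
  have hpd := h.properlyDiscontinuous_flowout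
  have hsub := AdS.T1_subset_flowout (Λ := Λ)
  have hfree' : AdS.ActsFreelyOn Γ (AdS.T1 (AdS.invisibleDomain Λ)) :=
    fun γ hγ x hx => hfree γ hγ x (hsub hx)
  have hpd' : AdS.ActsProperlyDiscontinuouslyOn Γ (AdS.T1 (AdS.invisibleDomain Λ)) :=
    fun K L hK hL => hpd K L (hK.trans hsub) (hL.trans hsub)
  have i1 := AdS.continuousConstSMul_sub (AdS.flowoutSub h)
  have i2 := AdS.locallyCompactSpace_sub (S := AdS.flowoutSub h) hW
  have i3 := AdS.properlyDiscontinuousSMul_sub (S := AdS.flowoutSub h) hpd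
  refine ⟨Set.ext fun p => AdS.mem_flowout, hW, AdS.φ_image_flowout,
    fun γ hγ => h.smul_image_flowout hγ, hfree, hpd, t2Space_of_properlyDiscontinuousSMul_of_t2Space,
    ContinuousConstSMul.secondCountableTopology, ?_⟩
  obtain ⟨c, cS, hQ, hm, he, hl⟩ := AdS.exists_quotientStructure (S := AdS.flowoutSub h) hW hfree hpd
  obtain ⟨c', cS', hQ', hm', he', hl'⟩ :=
    AdS.exists_quotientStructure (S := AdS.tangentSub h) h.acausal.T1_eq hfree' hpd'
  have hincl : IsLocalDiffeomorph 𝓘(ℝ, AdS.E5) 𝓘(ℝ, AdS.E5) ∞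
      (Set.inclusion hsub : AdS.tangentSub h → AdS.flowoutSub h) := by
    let _ : ChartedSpace AdS.E5 (AdS.T1 (AdS.invisibleDomain Λ)) := cS'
    let _ : ChartedSpace AdS.E5 (AdS.flowout Λ) := cS
    have : IsManifold 𝓘(ℝ, AdS.E5) ∞ (AdS.T1 (AdS.invisibleDomain Λ)) := hm'
    have : IsManifold 𝓘(ℝ, AdS.E5) ∞ (AdS.flowout Λ) := hm
    refine isLocalDiffeomorph_inclusion (S := AdS.T1 (AdS.invisibleDomain Λ))
      (T := AdS.flowout Λ) he' he hsub ?_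
    obtain ⟨W, hWo, hWe⟩ := h.acausal.T1_eq
    convert! hWo.preimage (continuous_subtype_val (p := (· ∈ AdS.flowout Λ))) using 1
    ext x
    rw [Set.mem_ofPred_eq, hWe]
    exact ⟨fun hx => hx.1, fun hx => ⟨hx, (AdS.mem_flowout.1 x.2).1⟩⟩
  have hinclQuo : IsLocalDiffeomorph 𝓘(ℝ, AdS.E5) 𝓘(ℝ, AdS.E5) ∞ (AdS.inclQuo h) := by
    intro y
    obtain ⟨x, rfl⟩ := AdS.isOpenQuotientMap_proj.surjective y
    -- `inclQuo` composed with the projection is the projection after the inclusion, a composite of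
    -- local diffeomorphisms.
    exact (hl' x).of_comp_right ((hincl x).comp _ _ (hl _))
  refine ⟨c, c', ⟨hQ, cS, hm, he, hl⟩, ⟨hQ', cS', hm', he', hl'⟩,
    .of_continuous_injective_isOpenMap hinclQuo.contMDiff.continuous (AdS.injective_inclQuo h)
      hinclQuo.isOpenMap, hinclQuo, AdS.quotientFlow h, AdS.quotientFlow_proj h, ?_⟩
  refine hl.contMDiff_prod_of_comp AdS.isOpenQuotientMap_proj.surjective ?_
  refine hl.contMDiff.comp (f := fun a : ℝ × AdS.flowoutSub h => AdS.flowoutFlow h a.1 a.2)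
    ((ContMDiff.iff_comp_isImmersion he.isImmersion).2 ⟨?_, ?_⟩)
  · exact ((AdS.contDiff_φ (n := 0)).continuous.comp
      (continuous_fst.prodMk (continuous_subtype_val.comp continuous_snd))).subtype_mk _
  · exact AdS.contDiff_φ.contMDiff.comp
      (contMDiff_fst.prodMk_space (he.contMDiff.comp contMDiff_snd))
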